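/- Notation. For $v\in\mathbb{R}^p$ and $S\subset\{1,\dots,p\}$ let $v_S$ be the vector that agrees with $v$ on $S$ and is zero off $S$; let $|v|_0$ be the number of nonzero coordinates of $v$, and $|v|_1$, $|v|_2$ its $\ell_1$ and Euclidean norms. For nonempty $S$ and $\alpha>0$ put $$\mathcal{C}(S,\alpha)=\{v\in\mathbb{R}^p : |v_{S^c}|_1\le \alpha\,|v_S|_1\},$$ and for $A\in\mathbb{R}^{p\times p}$ let $\mathrm{re}(A,S,\alpha)$ be the largest $R>0$ such that $R^2|v_S|_2^2\le v^TAv$ for all $v\in\mathcal{C}(S,\alpha)$ (and $0$ if there is no such $R$). Theorem. Let $n\ge 1$ and let $X_1,\dots,X_n\in\mathbb{R}^p$ be i.i.d. random vectors whose coordinates have finite moments of order $2q$ for some real $q>2$. Set $\Sigma=\mathbb{E}[X_1X_1^T]$ and $\widehat\Sigma_n=\frac1n\sum_{i=1}^nX_iX_i^T$, and let $\mathsf{h},\mathsf{h}_*\in(1,\infty)$ be such that $$\forall v\in\mathbb{R}^p:\ |v|_0\le n\ \Rightarrow\ \sqrt{\mathbb{E}[(v^TX_1)^4]}\le \mathsf{h}\,v^T\Sigma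 v,\qquad \forall\, 1\le j\le p:\ \big(\mathbb{E}\,|X_1[j]|^{2q}\big)^{1/q}\le \mathsf{h}_*\,\mathbb{E}\big[X_1[j]^2\big].$$ Let $\widehat D_{2,n}$ and $D_2$ be the diagonal matrices with the diagonals of $\widehat\Sigma_n$ and $\Sigma$, and put $\widehat{\mathbf X}_n=\widehat D_{2,n}^{-1/2}\widehat\Sigma_n\widehat D_{2,n}^{-1/2}$ and $\mathbf X=D_2^{-1/2}\Sigma D_2^{-1/2}$, where a diagonal entry of $\widehat D_{2,n}^{-1/2}$ (resp. $D_2^{-1/2}$) is taken to be $0$ if the corresponding entry of $\widehat D_{2,n}$ (resp. $D_2$) is $0$. Let $\delta,\varepsilon\in(0,1/2)$, let $\alpha>0$, let $S\subset\{1,\dots,p\}$ be nonempty with $|S|=s$, and set $$\tilde\alpha=\alpha\sqrt{\frac{1+\varepsilon}{1-\varepsilon}},\qquad C=784\,(1+\varepsilon)(1+\alpha)^2\,\mathsf{h}^2 .$$ Assume that $\mathrm{re}(\mathbf X,S,\tilde\alpha)>0$ and $$n\ \ge\ \max\left\{\frac{C\,\big(1+2\ln(p/(4\delta))\big)}{\mathrm{re}(\mathbf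 X,S,\tilde\alpha)^2\,\varepsilon^4}\;s,\ \ \frac{4q^2\,\mathsf{h}_*^2\,3^{2/q}\,s^{2/q}}{\varepsilon^2\,\delta^{2/q}}\right\}.$$ Then, with probability at least $1-\delta$, the following three properties hold simultaneously: 1. for every $x\in\mathbb{R}^p$ with $\widehat D_{2,n}^{1/2}x\in\mathcal{C}(S,\alpha)$ one has $D_2^{1/2}x\in\mathcal{C}(S,\tilde\alpha)$; 2. for every $x\in\mathbb{R}^p$ with $\widehat D_{2,n}^{1/2}x\in\mathcal{C}(S,\alpha)$ one has $x^T\widehat\Sigma_n x\ge(1-\varepsilon)^2\,x^T\Sigma x$; 3. $\mathrm{re}(\widehat{\mathbf X}_n,S,\alpha)\ge(1-\varepsilon)\,\mathrm{re}(\mathbf X,S,\tilde\alpha)$. -/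

import Mathlib

open MeasureTheory ProbabilityTheory
open scoped Matrix

noncomputable section

namespace RestrictedEigenvalue

variable {p n : ℕ}

/-- The `ℓ⁰` "norm" of `v`: the number of its nonzero coordinates. -/
def l0Norm (v : Fin p → ℝ) : ℕ := (Finset.univ.filter fun j => v j ≠ 0).card

/-- The `ℓ¹` norm of `v`. -/
def l1Norm (v : Fin p → ℝ) : ℝ := ∑ j, |v j|

/-- The Euclidean norm of `v`. -/
def l2Norm (v : Fin p → ℝ) : ℝ := √(∑ j, v j ^ 2)

/-- The restriction `v_S`: it agrees with `v` on `S` and vanishes off `S`. -/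
def restrictTo (S : Finset (Fin p)) (v : Fin p → ℝ) : Fin p → ℝ :=
  fun j => if j ∈ S then v j else 0

/-- The cone `C(S, α) = {v : |v_{Sᶜ}|₁ ≤ α |v_S|₁}`. -/
def cone (S : Finset (Fin p)) (α : ℝ) : Set (Fin p → ℝ) :=
  {v | l1Norm (restrictTo Sᶜ v) ≤ α * l1Norm (restrictTo S v)}

/-- The restricted eigenvalue constant `re(A, S, α)`: the largest `R` such that
`R² |v_S|₂² ≤ vᵀ A v` for all `v ∈ C(S, α)`. For nonempty `S` the set below is closed and bounded
above (by `√(A j j)`, `j ∈ S`), so the supremum is a maximum whenever the set is nonempty; the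
value is `0` exactly when no `R > 0` is admissible. -/
def re (A : Matrix (Fin p) (Fin p) ℝ) (S : Finset (Fin p)) (α : ℝ) : ℝ :=
  sSup {R : ℝ | 0 ≤ R ∧ ∀ v ∈ cone S α, R ^ 2 * l2Norm (restrictTo S v) ^ 2 ≤ v ⬝ᵥ (A *ᵥ v)}

/-- The second moment matrix `𝔼[Y Yᵀ]` of a random vector `Y`, with entries `𝔼[Y j * Y k]`. -/
def secondMoment {Ω : Type*} [MeasurableSpace Ω] (μ : Measure Ω) (Y : Ω → Fin p → ℝ) :
    Matrix (Fin p) (Fin p) ℝ :=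
  Matrix.of fun j k => ∫ ω, Y ω j * Y ω k ∂μ

/-- The sample second moment matrix `n⁻¹ ∑ᵢ xᵢ xᵢᵀ`. -/
def sampleSecondMoment (x : Fin n → Fin p → ℝ) : Matrix (Fin p) (Fin p) ℝ :=
  (n : ℝ)⁻¹ • ∑ i, Matrix.vecMulVec (x i) (x i)

/-- `D^{1/2}`, where `D` is the diagonal part of `A`. -/
def diagSqrt (A : Matrix (Fin p) (Fin p) ℝ) : Matrix (Fin p) (Fin p) ℝ :=
  Matrix.diagonal fun j => √(A j j)

/-- `D^{-1/2}`, where `D` is the diagonal part of `A`; an entry is zero where that of `D` is. -/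
def diagInvSqrt (A : Matrix (Fin p) (Fin p) ℝ) : Matrix (Fin p) (Fin p) ℝ :=
  Matrix.diagonal fun j => (√(A j j))⁻¹

/-- The diagonally normalized matrix `D^{-1/2} A D^{-1/2}`, where `D` is the diagonal part
of `A`. -/
def normalized (A : Matrix (Fin p) (Fin p) ℝ) : Matrix (Fin p) (Fin p) ℝ :=
  diagInvSqrt A * A * diagInvSqrt A

end RestrictedEigenvalue

end

/-!
Write `A` for the sample and `B` for the population second moment matrix. The claims on the cone
and on the restricted eigenvalue constants are deterministic consequences of three facts
(`diagSqrt_mulVec_mem_cone`, `one_sub_mul_re_le`): `A j j ≥ (1 - ε) B j j` for all `j`,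
`A j j ≤ (1 + ε) B j j` for `j ∈ S`, and `xᵀAx ≥ (1 - ε) xᵀBx` on the cone. The factor `1 - ε` is
better than the `(1 - ε)²` that is claimed, which pays for the change of normalization.

*Diagonal on `S`.* `L^q` is 2-smooth along independent centred increments (`lpNorm_add_sq_le`), so
`‖∑ Yᵢ‖_q ≤ q √n max ‖Yᵢ‖_q`, and Markov's inequality for the `q`-th moment gives a polynomial
deviation bound (`measureReal_lt_abs_average_sub_le`). A union bound over `S` costs `s ^ (2 / q)`
in the sample size.

*Quadratic form on the cone.* For a fixed sparse direction the average of the nonnegative variables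
`(vᵀXᵢ)²` has a sub-Gaussian lower tail under a fourth moment condition
(`measureReal_average_lt_le`). A union bound makes it hold for all sums of `d` atoms
`± e_j / √(r B_jj)`, `1 ≤ r ≤ K`, where `d` is of order `(1 + α)² s / (re² ε)` and `K` of order
`p / δ`. By Markov's inequality every `A j j` is below `K B j j`, so that each data-dependent scale
`√(A j j)` is within a factor two of one of the atoms' scales. An arbitrary `x` is then a positive
combination of atoms, and Maurey's empirical method (`exists_quadratic_sum_le`) transfers the lower
bound from sums of `d` atoms to `x`, with an error `O(|D^{1/2}x|₁² / d)`, where `D` is the diagonal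
of `A` (`quadratic_lower_bound_of_atoms`). On the cone this error is at most `ε / 2` times `xᵀBx`, by
the restricted eigenvalue condition for `B`. The union bound succeeds because the logarithm of the
number of sums, of order `d log (p / δ)`, is small against `n ε² / h²` (`card_pow_mul_exp_le`).
-/

/-! ### Cones, restricted eigenvalues and Maurey's method -/

namespace RestrictedEigenvalue

variable {p : ℕ}

lemma l1Norm_restrictTo (S : Finset (Fin p)) (v : Fin p → ℝ) :
    l1Norm (restrictTo S v) = ∑ j ∈ S, |v j| := by
  simp [l1Norm, restrictTo, apply_ite abs, Finset.sum_ite_mem]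

lemma l2Norm_restrictTo_sq (S : Finset (Fin p)) (v : Fin p → ℝ) :
    l2Norm (restrictTo S v) ^ 2 = ∑ j ∈ S, v j ^ 2 := by
  rw [l2Norm, Real.sq_sqrt (Finset.sum_nonneg fun _ _ => sq_nonneg _)]
  simp [restrictTo, ite_pow, Finset.sum_ite_mem]

lemma mem_cone_iff {S : Finset (Fin p)} {α : ℝ} {v : Fin p → ℝ} :
    v ∈ cone S α ↔ ∑ j ∈ Sᶜ, |v j| ≤ α * ∑ j ∈ S, |v j| := by
  rw [cone, Set.mem_ofPred_eq, l1Norm_restrictTo, l1Norm_restrictTo]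

/-- On the cone the `ℓ¹` norm is controlled by the Euclidean norm of the part carried by `S`. -/
lemma sq_sum_abs_le_of_mem_cone {S : Finset (Fin p)} {α : ℝ} (hα : 0 < α) {v : Fin p → ℝ}
    (hv : v ∈ cone S α) :
    (∑ j, |v j|) ^ 2 ≤ (1 + α) ^ 2 * (S.card * ∑ j ∈ S, v j ^ 2) := by
  have h1 : ∑ j, |v j| ≤ (1 + α) * ∑ j ∈ S, |v j| := by
    rw [← Finset.sum_add_sum_compl S]
    linarith [mem_cone_iff.1 hv]
  have h2 : (∑ j ∈ S, |v j|) ^ 2 ≤ S.card * ∑ j ∈ S, v j ^ 2 := by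
    simpa using sq_sum_le_card_mul_sum_sq (s := S) (f := fun j => |v j|)
  calc (∑ j, |v j|) ^ 2 ≤ ((1 + α) * ∑ j ∈ S, |v j|) ^ 2 :=
        pow_le_pow_left₀ (Finset.sum_nonneg fun _ _ => abs_nonneg _) h1 2
    _ = (1 + α) ^ 2 * (∑ j ∈ S, |v j|) ^ 2 := by ring
    _ ≤ _ := by gcongr

/-- A positive restricted eigenvalue constant is attained: it is itself admissible. -/
lemma re_sq_mul_le {A : Matrix (Fin p) (Fin p) ℝ} {S : Finset (Fin p)} {α : ℝ}
    (h : 0 < re A S α) {v : Fin p → ℝ} (hv : v ∈ cone S α) :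
    re A S α ^ 2 * ∑ j ∈ S, v j ^ 2 ≤ v ⬝ᵥ (A *ᵥ v) := by
  set T := {R : ℝ | 0 ≤ R ∧ ∀ v ∈ cone S α,
    R ^ 2 * l2Norm (restrictTo S v) ^ 2 ≤ v ⬝ᵥ (A *ᵥ v)} with hT
  have hre : re A S α = sSup T := rfl
  have hcl : IsClosed T := by
    simp only [hT, Set.ofPred_and, Set.ofPred_forall]
    refine isClosed_Ici.inter (isClosed_iInter fun v => isClosed_iInter fun _ => ?_)
    exact isClosed_le (by fun_prop) (by fun_prop)
  have hne : T.Nonempty := by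
    by_contra hn
    rw [hre, Set.not_nonempty_iff_eq_empty.1 hn, Real.sSup_empty] at h
    exact h.false
  have hbd : BddAbove T := by
    by_contra hn
    rw [hre, Real.sSup_of_not_bddAbove hn] at h
    exact h.false
  have := (hcl.csSup_mem hne hbd).2 v hv
  rwa [l2Norm_restrictTo_sq] at this

lemma single_mem_cone {S : Finset (Fin p)} {α : ℝ} (hα : 0 < α) {j : Fin p} (hj : j ∈ S) :
    Pi.single j 1 ∈ cone S α := by
  rw [mem_cone_iff, Finset.sum_eq_zero]
  · positivity
  · intro k hk
    rw [Finset.mem_compl] at hk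
    rw [Pi.single_eq_of_ne (by rintro rfl; exact hk hj), abs_zero]

lemma sum_single_sq {S : Finset (Fin p)} {j : Fin p} (hj : j ∈ S) :
    ∑ k ∈ S, (Pi.single j 1 : Fin p → ℝ) k ^ 2 = 1 := by
  rw [Finset.sum_eq_single j] <;> simp +contextual [hj]

lemma le_re {A : Matrix (Fin p) (Fin p) ℝ} {S : Finset (Fin p)} {α R : ℝ} (hα : 0 < α)
    (hS : S.Nonempty) (hR : 0 ≤ R)
    (h : ∀ v ∈ cone S α, R ^ 2 * ∑ j ∈ S, v j ^ 2 ≤ v ⬝ᵥ (A *ᵥ v)) : R ≤ re A S α := by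
  obtain ⟨j, hj⟩ := hS
  refine le_csSup ⟨√(A j j), ?_⟩ ⟨hR, fun v hv => by rw [l2Norm_restrictTo_sq]; exact h v hv⟩
  rintro R ⟨-, hR'⟩
  have := hR' _ (single_mem_cone hα hj)
  rw [l2Norm_restrictTo_sq, sum_single_sq hj] at this
  exact Real.le_sqrt_of_sq_le (by simpa using this)

lemma dotProduct_normalized_mulVec (A : Matrix (Fin p) (Fin p) ℝ) (v : Fin p → ℝ) :
    v ⬝ᵥ (normalized A *ᵥ v) = (diagInvSqrt A *ᵥ v) ⬝ᵥ (A *ᵥ (diagInvSqrt A *ᵥ v)) := by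
  rw [normalized, ← Matrix.mulVec_mulVec, ← Matrix.mulVec_mulVec, Matrix.dotProduct_mulVec]
  congr 1
  ext j
  simp [diagInvSqrt, Matrix.vecMul_diagonal, Matrix.mulVec_diagonal, mul_comm]

lemma normalized_apply_self_le_one (A : Matrix (Fin p) (Fin p) ℝ) (j : Fin p) :
    normalized A j j ≤ 1 := by
  have h : normalized A j j = (√(A j j))⁻¹ * A j j * (√(A j j))⁻¹ := by
    simp [normalized, diagInvSqrt]
  rw [h]
  rcases le_or_gt (A j j) 0 with h0 | h0
  · simp [Real.sqrt_eq_zero_of_nonpos h0]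
  · have h1 : 0 < √(A j j) := Real.sqrt_pos.2 h0
    nth_rw 2 [← Real.mul_self_sqrt h0.le]
    field_simp
    rfl

lemma re_sq_le {A : Matrix (Fin p) (Fin p) ℝ} {S : Finset (Fin p)} {α : ℝ} (hα : 0 < α)
    (h : 0 < re A S α) {j : Fin p} (hj : j ∈ S) : re A S α ^ 2 ≤ A j j := by
  have := re_sq_mul_le h (single_mem_cone hα hj)
  rw [sum_single_sq hj] at this
  simpa using this

lemma diag_pos_of_re_pos {B : Matrix (Fin p) (Fin p) ℝ} {S : Finset (Fin p)} {α : ℝ}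
    (hα : 0 < α) (hnn : ∀ j, 0 ≤ B j j) (h : 0 < re (normalized B) S α) {j : Fin p}
    (hj : j ∈ S) : 0 < B j j := by
  refine (hnn j).lt_of_ne' fun h0 => ?_
  have h3 := re_sq_le hα h hj
  have : normalized B j j = 0 := by simp [normalized, diagInvSqrt, h0]
  rw [this] at h3
  exact absurd h3 (not_le.2 (by positivity))

/-- The bound `xᵀBx ≥ re² |(D^{1/2}x)_S|₂²`, with `re` that of the normalization of `B`. Off the support
of the diagonal the rows of `Σ` vanish, so the convention `0⁻¹ = 0` does no harm. -/
lemma re_sq_mul_le_quadratic {B : Matrix (Fin p) (Fin p) ℝ} {S : Finset (Fin p)} {α : ℝ}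
    (hnn : ∀ j, 0 ≤ B j j) (hB : ∀ j k, B j j = 0 → B j k = 0 ∧ B k j = 0)
    (h : 0 < re (normalized B) S α) {x : Fin p → ℝ} (hx : diagSqrt B *ᵥ x ∈ cone S α) :
    re (normalized B) S α ^ 2 * ∑ j ∈ S, B j j * x j ^ 2 ≤ x ⬝ᵥ (B *ᵥ x) := by
  have h1 := re_sq_mul_le h hx
  rw [dotProduct_normalized_mulVec] at h1
  have h2 : ∀ j, (diagSqrt B *ᵥ x) j ^ 2 = B j j * x j ^ 2 := fun j => by
    simp [diagSqrt, Matrix.mulVec_diagonal, mul_pow, Real.sq_sqrt (hnn j)]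
  simp only [h2] at h1
  refine h1.trans_eq ?_
  have hy : ∀ j, B j j ≠ 0 → (diagInvSqrt B *ᵥ (diagSqrt B *ᵥ x)) j = x j := fun j hj => by
    simp only [diagSqrt, diagInvSqrt, Matrix.mulVec_diagonal]
    exact inv_mul_cancel_left₀ (Real.sqrt_pos.2 ((hnn j).lt_of_ne' hj)).ne' _
  generalize diagInvSqrt B *ᵥ (diagSqrt B *ᵥ x) = y at hy
  simp only [dotProduct, Matrix.mulVec, Finset.mul_sum]
  refine Finset.sum_congr rfl fun j _ => Finset.sum_congr rfl fun k _ => ?_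
  by_cases hj : B j j = 0
  · simp [(hB j k hj).1]
  by_cases hk : B k k = 0
  · simp [(hB k j hk).2]
  rw [hy j hj, hy k hk]

/-- Comparing the diagonals from above on `S` and from below everywhere carries the cone of the
empirical normalization into the larger cone of the population normalization. -/
lemma diagSqrt_mulVec_mem_cone {A B : Matrix (Fin p) (Fin p) ℝ} {S : Finset (Fin p)}
    {α ε : ℝ} (hα : 0 < α) (hε : 0 < ε) (hε' : ε < 1 / 2)
    (hlow : ∀ j, (1 - ε) * B j j ≤ A j j) (hup : ∀ j ∈ S, A j j ≤ (1 + ε) * B j j)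
    {x : Fin p → ℝ} (hx : diagSqrt A *ᵥ x ∈ cone S α) :
    diagSqrt B *ᵥ x ∈ cone S (α * √((1 + ε) / (1 - ε))) := by
  have h1 : 0 < 1 - ε := by linarith
  have h2 : 0 < √(1 - ε) := Real.sqrt_pos.2 h1
  rw [mem_cone_iff] at hx ⊢
  have habs : ∀ (C : Matrix (Fin p) (Fin p) ℝ) j, |(diagSqrt C *ᵥ x) j| = √(C j j) * |x j| := by
    intro C j
    simp [diagSqrt, Matrix.mulVec_diagonal, abs_mul, abs_of_nonneg (Real.sqrt_nonneg _)]
  simp only [habs] at hx ⊢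
  have h3 : √(1 - ε) * ∑ j ∈ Sᶜ, √(B j j) * |x j| ≤ ∑ j ∈ Sᶜ, √(A j j) * |x j| := by
    rw [Finset.mul_sum]
    refine Finset.sum_le_sum fun j _ => ?_
    rw [← mul_assoc, ← Real.sqrt_mul h1.le]
    gcongr
    exact hlow j
  have h4 : ∑ j ∈ S, √(A j j) * |x j| ≤ √(1 + ε) * ∑ j ∈ S, √(B j j) * |x j| := by
    rw [Finset.mul_sum]
    refine Finset.sum_le_sum fun j hj => ?_
    rw [← mul_assoc, ← Real.sqrt_mul (by linarith)]
    gcongr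
    exact hup j hj
  rw [Real.sqrt_div (by linarith)]
  have h5 : √(1 - ε) * ∑ j ∈ Sᶜ, √(B j j) * |x j| ≤
      α * (√(1 + ε) * ∑ j ∈ S, √(B j j) * |x j|) :=
    h3.trans (hx.trans (by gcongr))
  rw [← mul_le_mul_iff_right₀ h2]
  refine h5.trans_eq ?_
  field_simp

/-- A relative lower bound `1 - ε` for the quadratic form on the cone transfers to the restricted
eigenvalue constants of the normalizations. The change of normalization costs a factor `1 + ε`,
which `(1 - ε)² (1 + ε) ≤ 1 - ε` pays for. -/
lemma one_sub_mul_re_le {A B : Matrix (Fin p) (Fin p) ℝ} {S : Finset (Fin p)} (hS : S.Nonempty)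
    {α αt ε : ℝ} (hα : 0 < α) (hαt : 0 < αt) (hε : 0 < ε) (hε' : ε < 1 / 2)
    (hA : ∀ j, 0 ≤ A j j) (hnn : ∀ j, 0 ≤ B j j)
    (hB : ∀ j k, B j j = 0 → B j k = 0 ∧ B k j = 0)
    (h : 0 < re (normalized B) S αt)
    (hlow : ∀ j, (1 - ε) * B j j ≤ A j j) (hup : ∀ j ∈ S, A j j ≤ (1 + ε) * B j j)
    (hcone : ∀ x, diagSqrt A *ᵥ x ∈ cone S α → diagSqrt B *ᵥ x ∈ cone S αt)
    (hquad : ∀ x, diagSqrt A *ᵥ x ∈ cone S α →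
      (1 - ε) * (x ⬝ᵥ (B *ᵥ x)) ≤ x ⬝ᵥ (A *ᵥ x)) :
    (1 - ε) * re (normalized B) S αt ≤ re (normalized A) S α := by
  have h1 : 0 < 1 - ε := by linarith
  have hBpos : ∀ j ∈ S, 0 < B j j := fun j hj => diag_pos_of_re_pos hαt hnn h hj
  have hApos : ∀ j ∈ S, 0 < A j j := fun j hj =>
    (mul_pos h1 (hBpos j hj)).trans_le (hlow j)
  refine le_re hα hS (by positivity) fun v hv => ?_
  rw [dotProduct_normalized_mulVec]
  set x := diagInvSqrt A *ᵥ v with hx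
  have hxj : ∀ j, x j = (√(A j j))⁻¹ * v j := fun j => by
    simp [hx, diagInvSqrt, Matrix.mulVec_diagonal]
  have hvS : ∀ j ∈ S, (diagSqrt A *ᵥ x) j = v j := by
    intro j hj
    simp only [diagSqrt, Matrix.mulVec_diagonal, hxj]
    exact mul_inv_cancel_left₀ (Real.sqrt_pos.2 (hApos j hj)).ne' _
  have hvSc : ∀ j, |(diagSqrt A *ᵥ x) j| ≤ |v j| := by
    intro j
    simp only [diagSqrt, Matrix.mulVec_diagonal, hxj]
    by_cases h0 : √(A j j) = 0
    · simp [h0]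
    · rw [mul_inv_cancel_left₀ h0]
  have hmem : diagSqrt A *ᵥ x ∈ cone S α := by
    rw [mem_cone_iff] at hv ⊢
    rw [Finset.sum_congr rfl fun j hj => congrArg abs (hvS j hj)]
    exact (Finset.sum_le_sum fun j _ => hvSc j).trans hv
  have h4 := re_sq_mul_le_quadratic hnn hB h (hcone x hmem)
  have h5 : ∑ j ∈ S, v j ^ 2 ≤ (1 + ε) * ∑ j ∈ S, B j j * x j ^ 2 := by
    rw [Finset.mul_sum]
    refine Finset.sum_le_sum fun j hj => ?_
    rw [← hvS j hj, diagSqrt, Matrix.mulVec_diagonal, mul_pow, Real.sq_sqrt (hA j), ← mul_assoc]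
    exact mul_le_mul_of_nonneg_right (hup j hj) (sq_nonneg _)
  set r := re (normalized B) S αt
  have h6 : 0 ≤ r ^ 2 * ∑ j ∈ S, B j j * x j ^ 2 :=
    mul_nonneg (sq_nonneg _) (Finset.sum_nonneg fun j _ => mul_nonneg (hnn j) (sq_nonneg _))
  calc ((1 - ε) * r) ^ 2 * ∑ j ∈ S, v j ^ 2
      ≤ ((1 - ε) * r) ^ 2 * ((1 + ε) * ∑ j ∈ S, B j j * x j ^ 2) := by gcongr
    _ = (1 - ε) * (1 - ε ^ 2) * (r ^ 2 * ∑ j ∈ S, B j j * x j ^ 2) := by ring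
    _ ≤ (1 - ε) * 1 * (r ^ 2 * ∑ j ∈ S, B j j * x j ^ 2) := by
        gcongr
        linarith [sq_nonneg ε]
    _ ≤ (1 - ε) * (x ⬝ᵥ (B *ᵥ x)) := by
        rw [mul_one]
        gcongr
    _ ≤ _ := hquad x hmem

/-- Derandomized form of Maurey's empirical method: for a quadratic form and a convex combination
`x` of the vectors `u a`, some sum of `d` of these vectors does no worse than the sum of `d`
independent draws does on average. -/
lemma exists_quadratic_sum_le {ι : Type*} [Fintype ι] (A : Matrix (Fin p) (Fin p) ℝ)
    {w : ι → ℝ} (hw : ∀ a, 0 ≤ w a) (hw1 : ∑ a, w a = 1) (u : ι → Fin p → ℝ)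
    (d : ℕ) (y : Fin p → ℝ) :
    ∃ f : Fin d → ι,
      (y + ∑ k, u (f k)) ⬝ᵥ (A *ᵥ (y + ∑ k, u (f k))) ≤
        (y + (d : ℝ) • ∑ a, w a • u a) ⬝ᵥ (A *ᵥ (y + (d : ℝ) • ∑ a, w a • u a)) +
          d * (∑ a, w a * (u a ⬝ᵥ (A *ᵥ u a)) -
            (∑ a, w a • u a) ⬝ᵥ (A *ᵥ ∑ a, w a • u a)) := by
  set x := ∑ a, w a • u a with hx
  have key : ∀ z : Fin p → ℝ, ∃ a, (z + u a) ⬝ᵥ (A *ᵥ (z + u a)) ≤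
      (z + x) ⬝ᵥ (A *ᵥ (z + x)) + (∑ a, w a * (u a ⬝ᵥ (A *ᵥ u a)) - x ⬝ᵥ (A *ᵥ x)) := by
    intro z
    by_contra! hcon
    have h1 : ∑ a, w a * ((z + u a) ⬝ᵥ (A *ᵥ (z + u a))) =
        (z + x) ⬝ᵥ (A *ᵥ (z + x)) + (∑ a, w a * (u a ⬝ᵥ (A *ᵥ u a)) - x ⬝ᵥ (A *ᵥ x)) := by
      have e1 : ∑ a, w a * (z ⬝ᵥ (A *ᵥ u a)) = z ⬝ᵥ (A *ᵥ x) := by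
        rw [hx, Matrix.mulVec_sum, dotProduct_sum]
        simp [Matrix.mulVec_smul]
      have e2 : ∑ a, w a * (u a ⬝ᵥ (A *ᵥ z)) = x ⬝ᵥ (A *ᵥ z) := by
        rw [hx, sum_dotProduct]
        simp
      have e3 : ∑ a, w a * (z ⬝ᵥ (A *ᵥ z)) = z ⬝ᵥ (A *ᵥ z) := by
        rw [← Finset.sum_mul, hw1, one_mul]
      simp only [Matrix.mulVec_add, dotProduct_add, add_dotProduct, mul_add, Finset.sum_add_distrib,
        e1, e2, e3]
      ring
    have h2 : ∑ a, w a * ((z + x) ⬝ᵥ (A *ᵥ (z + x)) +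
        (∑ a, w a * (u a ⬝ᵥ (A *ᵥ u a)) - x ⬝ᵥ (A *ᵥ x))) <
        ∑ a, w a * ((z + u a) ⬝ᵥ (A *ᵥ (z + u a))) := by
      obtain ⟨a, -, ha⟩ : ∃ a ∈ Finset.univ, 0 < w a :=
        Finset.exists_lt_of_sum_lt (s := Finset.univ) (f := fun _ => (0 : ℝ)) (by simp [hw1])
      exact Finset.sum_lt_sum (fun b _ => mul_le_mul_of_nonneg_left (hcon b).le (hw b))
        ⟨a, Finset.mem_univ a, mul_lt_mul_of_pos_left (hcon a) ha⟩
    rw [h1, ← Finset.sum_mul, hw1, one_mul] at h2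
    exact h2.false
  induction d generalizing y with
  | zero => exact ⟨Fin.elim0, by simp⟩
  | succ d ih =>
    obtain ⟨a, ha⟩ := key (y + (d : ℝ) • x)
    obtain ⟨f, hf⟩ := ih (y + u a)
    refine ⟨Fin.cons a f, ?_⟩
    simp only [Fin.sum_univ_succ, Fin.cons_zero, Fin.cons_succ, ← add_assoc]
    have e1 : y + u a + (d : ℝ) • x = y + (d : ℝ) • x + u a := by abel
    have e2 : y + ((d + 1 : ℕ) : ℝ) • x = y + (d : ℝ) • x + x := by
      push_cast
      rw [add_smul, one_smul, add_assoc]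
    rw [e1] at hf
    rw [e2]
    push_cast
    linarith

end RestrictedEigenvalue

/-! ### A moment inequality for sums of independent variables -/

namespace RestrictedEigenvalue

/-- The tangent inequality for `t ↦ t ^ r`, multiplied out: `a ^ r ≥ c ^ r + r c ^ (r - 1) (a - c)`. -/
lemma rpow_tangent_le {r a c : ℝ} (hr : 1 < r) (ha : 0 ≤ a) (hc : 0 ≤ c) :
    c ^ r + r * c ^ (r - 1) * (a - c) ≤ a ^ r := by
  have h := Real.young_inequality_of_nonneg ha (Real.rpow_nonneg hc (r - 1))
    (Real.HolderConjugate.conjExponent hr)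
  have hr0 : r ≠ 0 := by positivity
  have hr1 : r - 1 ≠ 0 := by linarith
  have e1 : (c ^ (r - 1)) ^ (Real.conjExponent r) = c ^ r := by
    rw [← Real.rpow_mul hc, Real.conjExponent]
    congr 1
    field_simp
  have e2 : c ^ (r - 1) * c = c ^ r := by
    rw [← Real.rpow_add_one' hc (by linarith), sub_add_cancel]
  have e3 : c ^ r / Real.conjExponent r = c ^ r * (r - 1) / r := by
    rw [Real.conjExponent]
    field_simp
  rw [e1, e3] at h
  have h' := mul_le_mul_of_nonneg_left h (by linarith : 0 ≤ r)
  have e4 : r * (a ^ r / r + c ^ r * (r - 1) / r) = a ^ r + c ^ r * (r - 1) := by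
    field_simp
  rw [e4] at h'
  have e5 : r * c ^ (r - 1) * (a - c) = r * (a * c ^ (r - 1)) - r * c ^ r := by
    rw [← e2]; ring
  rw [e5]
  linarith

/-- A second order bound for `|·| ^ q`, where `q ≥ 2` need not be an integer. -/
lemma abs_add_rpow_le {q : ℝ} (hq : 2 < q) (a b : ℝ) :
    |a + b| ^ q ≤ |a| ^ q + q * (a * |a| ^ (q - 2)) * b +
      q * (q - 1) * (b ^ 2 * (|a| + |b|) ^ (q - 2)) := by
  wlog ha : 0 ≤ a generalizing a b
  · have := this (-a) (-b) (by linarith)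
    rw [← neg_add, abs_neg, abs_neg, abs_neg] at this
    refine this.trans_eq ?_
    ring
  rw [abs_of_nonneg ha]
  have hq2 : 0 < q - 2 := by linarith
  have hmul : ∀ t : ℝ, 0 ≤ t → t ^ (q - 1) = t * t ^ (q - 2) := fun t ht => by
    rw [mul_comm, ← Real.rpow_add_one' ht (by linarith)]
    congr 1; ring
  set T := a + |b| with hT
  have hT0 : 0 ≤ T := by positivity
  rcases le_or_gt 0 (a + b) with hc | hc
  · -- convexity at `a + b` bounds the increment by the derivative there
    rw [abs_of_nonneg hc]
    have h1 := rpow_tangent_le (r := q) (by linarith) ha hc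
    have h2 : (a + b) ^ (q - 1) * b ≤ a ^ (q - 1) * b + (q - 1) * (b ^ 2 * T ^ (q - 2)) := by
      rcases le_or_gt 0 b with hb | hb
      · have h3 := rpow_tangent_le (r := q - 1) (by linarith) ha hc
        rw [show q - 1 - 1 = q - 2 by ring] at h3
        have h4 : (a + b) ^ (q - 2) ≤ T ^ (q - 2) :=
          Real.rpow_le_rpow hc (by rw [hT, abs_of_nonneg hb]) hq2.le
        have h5 : (a + b) ^ (q - 1) ≤ a ^ (q - 1) + (q - 1) * T ^ (q - 2) * b := by
          have : (q - 1) * (a + b) ^ (q - 2) * b ≤ (q - 1) * T ^ (q - 2) * b := by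
            gcongr
            linarith
          linarith
        calc (a + b) ^ (q - 1) * b ≤ (a ^ (q - 1) + (q - 1) * T ^ (q - 2) * b) * b := by gcongr
          _ = _ := by ring
      · have h3 := rpow_tangent_le (r := q - 1) (by linarith) hc ha
        rw [show q - 1 - 1 = q - 2 by ring] at h3
        have h4 : a ^ (q - 2) ≤ T ^ (q - 2) :=
          Real.rpow_le_rpow ha (by rw [hT]; linarith [abs_nonneg b]) hq2.le
        have h5 : a ^ (q - 1) ≤ (a + b) ^ (q - 1) + (q - 1) * T ^ (q - 2) * (-b) := by
          have : (q - 1) * a ^ (q - 2) * (-b) ≤ (q - 1) * T ^ (q - 2) * (-b) := by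
            gcongr
            · linarith
            · linarith
          linarith
        have h6 := mul_le_mul_of_nonneg_right h5 (neg_nonneg.2 hb.le)
        linarith
    rw [← hmul a ha]
    have h7 : q * ((a + b) ^ (q - 1) * b) ≤
        q * (a ^ (q - 1) * b + (q - 1) * (b ^ 2 * T ^ (q - 2))) := by gcongr
    have e : (a + b) ^ q ≤ a ^ q + q * ((a + b) ^ (q - 1) * b) := by
      have : q * (a + b) ^ (q - 1) * (a - (a + b)) = - (q * ((a + b) ^ (q - 1) * b)) := by ring
      linarith
    linarith
  · -- here `a` and `a + b` have opposite signs, so both are at most `|b|`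
    have hb : b < 0 := by linarith
    rw [abs_of_neg hc]
    have h1 := rpow_tangent_le (r := q) (a := 0) (by linarith) le_rfl (neg_nonneg.2 hc.le)
    have hc' : 0 ≤ -(a + b) := by linarith
    rw [Real.zero_rpow (by positivity)] at h1
    have hab : |b| = -b := abs_of_neg hb
    have h2 : (-(a + b)) ^ (q - 2) ≤ T ^ (q - 2) :=
      Real.rpow_le_rpow hc' (by linarith) hq2.le
    have h3 : a ^ (q - 2) ≤ T ^ (q - 2) := Real.rpow_le_rpow ha (by linarith) hq2.le
    have hTq : 0 ≤ T ^ (q - 2) := Real.rpow_nonneg hT0 _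
    have h4 : (-(a + b)) ^ q = (-(a + b)) ^ 2 * (-(a + b)) ^ (q - 2) := by
      rw [← Real.rpow_natCast, ← Real.rpow_add' hc' (by norm_num; linarith)]
      congr 1; norm_num
    have h5 : (-(a + b)) ^ q ≤ (-(a + b)) ^ 2 * T ^ (q - 2) := by
      rw [h4]; gcongr
    have h6 : 0 ≤ a ^ q := Real.rpow_nonneg ha _
    have h7 : q * (a * a ^ (q - 2)) * (-b) ≤ q * (a * T ^ (q - 2)) * (-b) := by
      gcongr
      linarith
    have h8 : 0 ≤ (q * (q - 1) * b ^ 2 + q * a * b - (a + b) ^ 2) * T ^ (q - 2) := by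
      refine mul_nonneg ?_ hTq
      nlinarith [mul_nonneg ha hc', mul_pos (neg_pos.2 hb) (by linarith : 0 < q - 2),
        mul_nonneg (mul_nonneg ha hc') (by linarith : 0 ≤ q - 2), mul_nonneg hc' hc',
        mul_nonneg (sq_nonneg b) hq2.le, mul_nonneg (mul_nonneg (neg_nonneg.2 hb.le) hc') hq2.le,
        mul_nonneg (mul_nonneg (sq_nonneg b) hq2.le) hq2.le]
    nlinarith [h8, h5, h7, h6]

/-- The numerical inequality behind the induction step of the moment bound for sums of independent
variables. -/
lemma rpow_add_mul_le {q m x : ℝ} (hq : 2 < q) (hm : 0 ≤ m) (hx : 0 ≤ x) :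
    m ^ q + q * (q - 1) * (x ^ 2 * (m + x) ^ (q - 2)) ≤ (m ^ 2 + q ^ 2 * x ^ 2) ^ (q / 2) := by
  have hq2 : 0 ≤ q - 2 := by linarith
  have hsq : ∀ t : ℝ, 0 ≤ t → (t ^ 2) ^ (q / 2 - 1) = t ^ (q - 2) := fun t ht => by
    rw [← Real.rpow_natCast, ← Real.rpow_mul ht]
    congr 1; push_cast; ring
  have hmq : m ^ q = m ^ 2 * m ^ (q - 2) := by
    rw [← Real.rpow_natCast, ← Real.rpow_add' hm (by norm_num; linarith)]
    congr 1; norm_num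
  have hN : 0 ≤ m ^ 2 + q ^ 2 * x ^ 2 := by positivity
  rcases le_or_gt ((m + x) ^ 2) (m ^ 2 + q ^ 2 * x ^ 2) with hle | hgt
  · set N := m ^ 2 + q ^ 2 * x ^ 2
    have e : N ^ (q / 2) = N * N ^ (q / 2 - 1) := by
      rw [mul_comm, ← Real.rpow_add_one' hN (by linarith), sub_add_cancel]
    have h1 : m ^ (q - 2) ≤ N ^ (q / 2 - 1) := by
      rw [← hsq m hm]
      exact Real.rpow_le_rpow (by positivity) (by simp only [N]; nlinarith [sq_nonneg (q * x)])
        (by linarith)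
    have h2 : (m + x) ^ (q - 2) ≤ N ^ (q / 2 - 1) := by
      rw [← hsq (m + x) (by positivity)]
      exact Real.rpow_le_rpow (by positivity) hle (by linarith)
    calc m ^ q + q * (q - 1) * (x ^ 2 * (m + x) ^ (q - 2))
        ≤ m ^ 2 * N ^ (q / 2 - 1) + q * q * (x ^ 2 * N ^ (q / 2 - 1)) := by
          rw [hmq]
          gcongr
          linarith
      _ = N ^ (q / 2) := by rw [e]; simp only [N]; ring
  · have hx0 : 0 < x := by
      refine hx.lt_of_ne fun h => ?_
      subst h
      simp at hgt
    -- here `x < 2 m / (q² - 1)`, and Bernoulli's inequality suffices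
    have h1 : (q ^ 2 - 1) * x < 2 * m := by
      by_contra! hcon
      nlinarith [mul_le_mul_of_nonneg_right hcon hx]
    have hm0 : 0 < m := by
      have : 0 < (q ^ 2 - 1) * x := mul_pos (by nlinarith) hx0
      linarith
    have hB := one_add_mul_self_le_rpow_one_add (s := q ^ 2 * x ^ 2 / m ^ 2)
      (by have : 0 ≤ q ^ 2 * x ^ 2 / m ^ 2 := by positivity
          linarith) (p := q / 2) (by linarith)
    have e1 : (m ^ 2 + q ^ 2 * x ^ 2) ^ (q / 2) = m ^ q * (1 + q ^ 2 * x ^ 2 / m ^ 2) ^ (q / 2) := by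
      have : m ^ q = (m ^ 2) ^ (q / 2) := by
        rw [← Real.rpow_natCast, ← Real.rpow_mul hm]
        congr 1; push_cast; ring
      rw [this, ← Real.mul_rpow (by positivity) (by positivity)]
      congr 1; field_simp
    have h2 : (m + x) ^ (q - 2) ≤ m ^ (q - 2) * 2 := by
      have hxm : 0 ≤ x / m := by positivity
      have e2 : m + x = m * (1 + x / m) := by field_simp
      rw [e2, Real.mul_rpow hm (by positivity)]
      gcongr
      have h3 : 1 + x / m ≤ Real.exp (x / m) := by linarith [Real.add_one_le_exp (x / m)]
      calc (1 + x / m) ^ (q - 2) ≤ Real.exp (x / m) ^ (q - 2) :=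
            Real.rpow_le_rpow (by positivity) h3 hq2
        _ = Real.exp (x / m * (q - 2)) := by rw [← Real.exp_mul]
        _ ≤ Real.exp (1 / 2) := by
            apply Real.exp_le_exp.2
            rw [div_mul_eq_mul_div, div_le_iff₀ hm0]
            nlinarith [sq_nonneg (q - 2)]
        _ ≤ 2 := by
            have := Real.exp_one_lt_d9
            have h4 : Real.exp (1 / 2) ^ 2 = Real.exp 1 := by
              rw [← Real.exp_nat_mul]; norm_num
            nlinarith [Real.exp_pos (1 / 2)]
    have hmp : 0 < m ^ (q - 2) := Real.rpow_pos_of_pos hm0 _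
    calc m ^ q + q * (q - 1) * (x ^ 2 * (m + x) ^ (q - 2))
        ≤ m ^ q + q * (q - 1) * (x ^ 2 * (m ^ (q - 2) * 2)) := by
          have : 0 ≤ q * (q - 1) := by nlinarith
          gcongr
      _ ≤ m ^ q * (1 + q / 2 * (q ^ 2 * x ^ 2 / m ^ 2)) := by
          rw [hmq]
          have e3 : m ^ 2 * m ^ (q - 2) * (1 + q / 2 * (q ^ 2 * x ^ 2 / m ^ 2)) =
              m ^ 2 * m ^ (q - 2) + q * (q ^ 2 / 2) * (x ^ 2 * m ^ (q - 2)) := by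
            field_simp
          rw [e3]
          have : 2 * (q - 1) ≤ q ^ 2 / 2 := by nlinarith [sq_nonneg (q - 2)]
          have h5 : q * (2 * (q - 1)) * (x ^ 2 * m ^ (q - 2)) ≤
              q * (q ^ 2 / 2) * (x ^ 2 * m ^ (q - 2)) := by gcongr
          linarith
      _ ≤ _ := by
          rw [e1]
          gcongr

variable {Ω : Type*} [MeasurableSpace Ω] {μ : Measure Ω}

lemma integral_abs_rpow_eq {q : ℝ} (hq : 0 < q) {f : Ω → ℝ}
    (hf : AEStronglyMeasurable f μ) :
    ∫ ω, |f ω| ^ q ∂μ = lpNorm f (ENNReal.ofReal q) μ ^ q := by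
  rw [lpNorm_eq_integral_norm_rpow_toReal (by simpa using hq) (by simp) hf,
    ENNReal.toReal_ofReal hq.le, Real.rpow_inv_rpow _ hq.ne']
  · rfl
  · exact integral_nonneg fun _ => Real.rpow_nonneg (norm_nonneg _) _

lemma integrable_abs_rpow {q : ℝ} (hq : 0 < q) {f : Ω → ℝ}
    (hf : MemLp f (ENNReal.ofReal q) μ) : Integrable (fun ω => |f ω| ^ q) μ := by
  have := hf.integrable_norm_rpow (by simpa using hq) (by simp)
  simpa [ENNReal.toReal_ofReal hq.le] using this

/-- The space `L^q` with `q > 2` is 2-smooth with constant `q`, along independent centred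
increments. -/
lemma lpNorm_add_sq_le [IsProbabilityMeasure μ] {q : ℝ} (hq : 2 < q) {M Y : Ω → ℝ}
    (hM : MemLp M (ENNReal.ofReal q) μ) (hY : MemLp Y (ENNReal.ofReal q) μ)
    (hMY : IndepFun M Y μ) (hY0 : ∫ ω, Y ω ∂μ = 0) :
    lpNorm (M + Y) (ENNReal.ofReal q) μ ^ 2 ≤
      lpNorm M (ENNReal.ofReal q) μ ^ 2 + q ^ 2 * lpNorm Y (ENNReal.ofReal q) μ ^ 2 := by
  set P := ENNReal.ofReal q with hP
  have hq0 : 0 < q := by linarith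
  have hP1 : 1 ≤ P := by rw [hP]; exact ENNReal.one_le_ofReal.2 (by linarith)
  set m := lpNorm M P μ with hm
  set x := lpNorm Y P μ with hx
  have hm0 : 0 ≤ m := lpNorm_nonneg
  have hx0 : 0 ≤ x := lpNorm_nonneg
  have hsum : MemLp (fun ω => |M ω| + |Y ω|) P μ := hM.abs.add hY.abs
  -- the first order term vanishes by independence
  have hψ : Measurable fun t : ℝ => t * |t| ^ (q - 2) := by fun_prop
  have hψi : Integrable (fun ω => M ω * |M ω| ^ (q - 2)) μ := by
    have h1 : MemLp M (ENNReal.ofReal (q - 1)) μ :=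
      hM.mono_exponent (ENNReal.ofReal_le_ofReal (by linarith))
    refine (integrable_abs_rpow (by linarith) h1).mono' ?_ ?_
    · exact (hψ.comp_aemeasurable hM.aestronglyMeasurable.aemeasurable).aestronglyMeasurable
    · filter_upwards with ω
      rw [Real.norm_eq_abs, abs_mul, abs_of_nonneg (Real.rpow_nonneg (abs_nonneg _) _), mul_comm,
        ← Real.rpow_add_one' (abs_nonneg _) (by linarith)]
      exact le_of_eq (by congr 1; ring)
  have hYi : Integrable Y μ := hY.integrable hP1
  have hind : IndepFun (fun ω => M ω * |M ω| ^ (q - 2)) Y μ := hMY.comp hψ measurable_id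
  have hcross_i : Integrable (fun ω => q * (M ω * |M ω| ^ (q - 2)) * Y ω) μ := by
    have := (hind.integrable_mul hψi hYi).const_mul q
    refine this.congr (ae_of_all _ fun ω => ?_)
    simp [mul_assoc]
  have hcross : ∫ ω, q * (M ω * |M ω| ^ (q - 2)) * Y ω ∂μ = 0 := by
    have h1 := hind.integral_fun_mul_eq_mul_integral hψi.aestronglyMeasurable
      hYi.aestronglyMeasurable
    rw [hY0, mul_zero] at h1
    simp_rw [mul_assoc q]
    rw [integral_const_mul, h1, mul_zero]
  -- Hölder's inequality for the second order term
  have hconj : (q / 2).HolderConjugate (q / (q - 2)) := by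
    rw [Real.holderConjugate_iff]
    refine ⟨by linarith, ?_⟩
    have : q - 2 ≠ 0 := by linarith
    field_simp
    ring
  have hf1 : MemLp (fun ω => Y ω ^ 2) (ENNReal.ofReal (q / 2)) μ := by
    have := hY.norm_rpow_div (2 : ENNReal)
    have e : P / 2 = ENNReal.ofReal (q / 2) := by
      rw [hP, ENNReal.ofReal_div_of_pos (by norm_num)]; simp
    rw [e] at this
    refine this.congr_norm ?_ (ae_of_all _ fun ω => ?_)
    · exact hY.aestronglyMeasurable.pow 2
    · simp
  have hf2 : MemLp (fun ω => (|M ω| + |Y ω|) ^ (q - 2)) (ENNReal.ofReal (q / (q - 2))) μ := by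
    have := hsum.norm_rpow_div (ENNReal.ofReal (q - 2))
    have e : P / ENNReal.ofReal (q - 2) = ENNReal.ofReal (q / (q - 2)) := by
      rw [hP, ENNReal.ofReal_div_of_pos (by linarith)]
    rw [e, ENNReal.toReal_ofReal (by linarith)] at this
    refine this.congr_norm ?_ (ae_of_all _ fun ω => ?_)
    · exact (hsum.aestronglyMeasurable.aemeasurable.pow_const _).aestronglyMeasurable
    · simp only [Real.norm_eq_abs]
      rw [abs_of_nonneg (by positivity : 0 ≤ |M ω| + |Y ω|)]
  have hsec_i : Integrable (fun ω => Y ω ^ 2 * (|M ω| + |Y ω|) ^ (q - 2)) μ :=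
    haveI : ENNReal.HolderConjugate (ENNReal.ofReal (q / 2)) (ENNReal.ofReal (q / (q - 2))) :=
      hconj.ennrealOfReal
    hf1.integrable_mul hf2
  have hhold := integral_mul_le_Lp_mul_Lq_of_nonneg hconj
    (ae_of_all μ fun ω => sq_nonneg (Y ω))
    (ae_of_all μ fun ω => Real.rpow_nonneg (by positivity : 0 ≤ |M ω| + |Y ω|) (q - 2)) hf1 hf2
  have e1 : (∫ ω, (Y ω ^ 2) ^ (q / 2) ∂μ) ^ (1 / (q / 2)) = x ^ 2 := by
    have : ∀ ω, (Y ω ^ 2) ^ (q / 2) = |Y ω| ^ q := fun ω => by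
      rw [← sq_abs, ← Real.rpow_natCast, ← Real.rpow_mul (abs_nonneg _)]
      congr 1; push_cast; ring
    simp_rw [this]
    rw [integral_abs_rpow_eq hq0 hY.aestronglyMeasurable, ← Real.rpow_mul hx0,
      ← Real.rpow_natCast]
    congr 1; field_simp; norm_num
  have e2 : (∫ ω, ((|M ω| + |Y ω|) ^ (q - 2)) ^ (q / (q - 2)) ∂μ) ^ (1 / (q / (q - 2))) =
      lpNorm (fun ω => |M ω| + |Y ω|) P μ ^ (q - 2) := by
    have hq2 : q - 2 ≠ 0 := by linarith
    have : ∀ ω, ((|M ω| + |Y ω|) ^ (q - 2)) ^ (q / (q - 2)) = |(|M ω| + |Y ω|)| ^ q := fun ω => by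
      rw [abs_of_nonneg (by positivity : 0 ≤ |M ω| + |Y ω|), ← Real.rpow_mul (by positivity)]
      congr 1; field_simp
    simp_rw [this]
    rw [integral_abs_rpow_eq hq0 hsum.aestronglyMeasurable, ← Real.rpow_mul lpNorm_nonneg]
    congr 1; field_simp
  have hmink : lpNorm (fun ω => |M ω| + |Y ω|) P μ ≤ m + x := by
    have := lpNorm_add_le (g := fun ω => |Y ω|) hM.abs hP1
    have e3 : lpNorm (fun ω => |M ω|) P μ = m := lpNorm_fun_abs hM.aestronglyMeasurable P
    have e4 : lpNorm (fun ω => |Y ω|) P μ = x := lpNorm_fun_abs hY.aestronglyMeasurable P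
    calc _ ≤ lpNorm (fun ω => |M ω|) P μ + lpNorm (fun ω => |Y ω|) P μ := this
      _ = _ := by rw [e3, e4]
  have hsec : ∫ ω, Y ω ^ 2 * (|M ω| + |Y ω|) ^ (q - 2) ∂μ ≤ x ^ 2 * (m + x) ^ (q - 2) := by
    rw [e1, e2] at hhold
    refine hhold.trans ?_
    gcongr
    exact lpNorm_nonneg
  have hmain : lpNorm (M + Y) P μ ^ q ≤ (m ^ 2 + q ^ 2 * x ^ 2) ^ (q / 2) := by
    rw [← integral_abs_rpow_eq hq0 (hM.add hY).aestronglyMeasurable]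
    calc ∫ ω, |(M + Y) ω| ^ q ∂μ
        ≤ ∫ ω, (|M ω| ^ q + q * (M ω * |M ω| ^ (q - 2)) * Y ω +
            q * (q - 1) * (Y ω ^ 2 * (|M ω| + |Y ω|) ^ (q - 2))) ∂μ :=
          integral_mono (integrable_abs_rpow hq0 (hM.add hY))
            (((integrable_abs_rpow hq0 hM).add hcross_i).add (hsec_i.const_mul _))
            fun ω => abs_add_rpow_le hq (M ω) (Y ω)
      _ = m ^ q + q * (q - 1) * ∫ ω, Y ω ^ 2 * (|M ω| + |Y ω|) ^ (q - 2) ∂μ := by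
          rw [integral_add (f := fun ω => |M ω| ^ q + q * (M ω * |M ω| ^ (q - 2)) * Y ω)
            ((integrable_abs_rpow hq0 hM).add hcross_i) (hsec_i.const_mul _),
            integral_add (integrable_abs_rpow hq0 hM) hcross_i, hcross,
            integral_abs_rpow_eq hq0 hM.aestronglyMeasurable, integral_const_mul, add_zero]
      _ ≤ m ^ q + q * (q - 1) * (x ^ 2 * (m + x) ^ (q - 2)) := by
          have : 0 ≤ q * (q - 1) := by nlinarith
          gcongr
      _ ≤ _ := rpow_add_mul_le hq hm0 hx0
  have h0 : 0 ≤ lpNorm (M + Y) P μ := lpNorm_nonneg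
  have e5 : lpNorm (M + Y) P μ ^ q = (lpNorm (M + Y) P μ ^ 2) ^ (q / 2) := by
    rw [← Real.rpow_natCast, ← Real.rpow_mul h0]
    congr 1; push_cast; ring
  rw [e5] at hmain
  exact (Real.rpow_le_rpow_iff (by positivity) (by positivity) (by linarith)).1 hmain

/-- Moment bound for sums of independent centred variables: `‖∑ᵢ Yᵢ‖_q ≤ q √n max ‖Yᵢ‖_q`. -/
lemma lpNorm_sum_sq_le [IsProbabilityMeasure μ] {ι : Type*} {q x : ℝ} (hq : 2 < q)
    {Y : ι → Ω → ℝ} (hYm : ∀ i, Measurable (Y i)) (hY : ∀ i, MemLp (Y i) (ENNReal.ofReal q) μ)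
    (hind : iIndepFun Y μ) (hY0 : ∀ i, ∫ ω, Y i ω ∂μ = 0)
    (hx : ∀ i, lpNorm (Y i) (ENNReal.ofReal q) μ ≤ x) (s : Finset ι) :
    lpNorm (∑ i ∈ s, Y i) (ENNReal.ofReal q) μ ^ 2 ≤ s.card * (q ^ 2 * x ^ 2) := by
  classical
  induction s using Finset.induction_on with
  | empty => simp
  | insert a s ha ih =>
    rw [Finset.sum_insert ha, add_comm, Finset.card_insert_of_notMem ha]
    have h1 := lpNorm_add_sq_le hq (memLp_finsetSum' s fun i _ => hY i) (hY a)
      (hind.indepFun_finsetSum_of_notMem hYm ha) (hY0 a)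
    have h2 : lpNorm (Y a) (ENNReal.ofReal q) μ ^ 2 ≤ x ^ 2 :=
      pow_le_pow_left₀ lpNorm_nonneg (hx a) 2
    push_cast
    nlinarith [mul_le_mul_of_nonneg_left h2 (sq_nonneg q)]

end RestrictedEigenvalue

/-! ### Tail bounds for averages -/

namespace RestrictedEigenvalue

variable {Ω : Type*} [MeasurableSpace Ω] {μ : Measure Ω}

lemma exp_neg_le_quadratic {u : ℝ} (hu : 0 ≤ u) : Real.exp (-u) ≤ 1 - u + u ^ 2 / 2 := by
  have h1 := Real.quadratic_le_exp_of_nonneg hu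
  rw [Real.exp_neg, inv_le_comm₀ (Real.exp_pos u) (by nlinarith [sq_nonneg (u - 1)])]
  refine le_trans ?_ h1
  rw [inv_le_iff_one_le_mul₀ (by nlinarith [sq_nonneg (u - 1)])]
  nlinarith [sq_nonneg (u ^ 2)]

/-- Lower tail of an average of nonnegative i.i.d. variables: only a second moment is needed,
since `exp (-t Y)` is bounded. -/
lemma measureReal_average_lt_le [IsProbabilityMeasure μ] {n : ℕ} [NeZero n] {Y : Fin n → Ω → ℝ}
    (hYm : ∀ i, Measurable (Y i)) (hind : iIndepFun Y μ)
    (hid : ∀ i, IdentDistrib (Y i) (Y 0) μ μ) (hnn : ∀ i ω, 0 ≤ Y i ω)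
    (hL2 : MemLp (Y 0) 2 μ) {h η : ℝ} (hh : 0 < h) (hη : 0 ≤ η)
    (hmom : √(∫ ω, Y 0 ω ^ 2 ∂μ) ≤ h * ∫ ω, Y 0 ω ∂μ) :
    μ.real {ω | (n : ℝ)⁻¹ * ∑ i, Y i ω < (1 - η) * ∫ ω, Y 0 ω ∂μ} ≤
      Real.exp (-(n * η ^ 2 / (2 * h ^ 2))) := by
  set m := ∫ ω, Y 0 ω ∂μ with hm
  have hn : (0 : ℝ) < n := by exact_mod_cast Nat.pos_of_ne_zero (NeZero.ne n)
  have hm0 : 0 ≤ m := integral_nonneg (hnn 0)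
  rcases hm0.eq_or_lt with h0 | hmpos
  · have : {ω | (n : ℝ)⁻¹ * ∑ i, Y i ω < (1 - η) * m} = ∅ := by
      ext ω
      simp only [Set.mem_ofPred_eq, Set.mem_empty_iff_false, iff_false, not_lt, ← h0, mul_zero]
      exact mul_nonneg (by positivity) (Finset.sum_nonneg fun i _ => hnn i ω)
    rw [this, measureReal_empty]
    positivity
  have hsq : ∫ ω, Y 0 ω ^ 2 ∂μ ≤ (h * m) ^ 2 := (Real.sqrt_le_left (by positivity)).1 hmom
  -- the exponent `t` minimizes `-t η m + t² h² m² / 2`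
  set t := η / (h ^ 2 * m) with ht
  have ht0 : 0 ≤ t := by positivity
  have hbd : ∀ i, Integrable (fun ω => Real.exp (-t * Y i ω)) μ := fun i => by
    refine Integrable.of_bound (C := 1) (by have := hYm i; fun_prop) (ae_of_all _ fun ω => ?_)
    rw [Real.norm_eq_abs, Real.abs_exp, Real.exp_le_one_iff]
    have := mul_nonneg ht0 (hnn i ω)
    linarith
  have hmgf0 : mgf (Y 0) μ (-t) ≤ Real.exp (-(t * m) + t ^ 2 * (h * m) ^ 2 / 2) := by
    have hi2 := hL2.integrable_sq
    have hi1 := hL2.integrable one_le_two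
    calc mgf (Y 0) μ (-t) = ∫ ω, Real.exp (-t * Y 0 ω) ∂μ := rfl
      _ ≤ ∫ ω, (1 - t * Y 0 ω + t ^ 2 / 2 * Y 0 ω ^ 2) ∂μ := by
          refine integral_mono (hbd 0)
            (((integrable_const 1).sub (hi1.const_mul t)).add (hi2.const_mul _)) fun ω => ?_
          have := exp_neg_le_quadratic (mul_nonneg ht0 (hnn 0 ω))
          rw [← neg_mul] at this
          refine this.trans_eq ?_
          ring
      _ = 1 - t * m + t ^ 2 / 2 * ∫ ω, Y 0 ω ^ 2 ∂μ := by
          rw [integral_add (f := fun ω => 1 - t * Y 0 ω)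
            ((integrable_const 1).sub (hi1.const_mul t)) (hi2.const_mul _),
            integral_sub (integrable_const 1) (hi1.const_mul t), integral_const_mul,
            integral_const_mul]
          simp [hm]
      _ ≤ 1 - t * m + t ^ 2 / 2 * (h * m) ^ 2 := by gcongr
      _ ≤ _ := by
          have := Real.add_one_le_exp (-(t * m) + t ^ 2 * (h * m) ^ 2 / 2)
          linarith
  have hmgf : ∀ i, mgf (Y i) μ (-t) ≤ Real.exp (-(t * m) + t ^ 2 * (h * m) ^ 2 / 2) := fun i => by
    rw [mgf_congr_identDistrib (hid i)]
    exact hmgf0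
  have hexp : Integrable (fun ω => Real.exp (-t * (∑ i, Y i) ω)) μ :=
    hind.integrable_exp_mul_sum hYm fun i _ => hbd i
  have hcher := measure_le_le_exp_mul_mgf (X := ∑ i, Y i) (μ := μ) (n * ((1 - η) * m))
    (neg_nonpos.2 ht0) hexp
  have hsub : {ω | (n : ℝ)⁻¹ * ∑ i, Y i ω < (1 - η) * m} ⊆
      {ω | (∑ i, Y i) ω ≤ n * ((1 - η) * m)} := by
    intro ω hω
    simp only [Set.mem_ofPred_eq, Finset.sum_apply] at hω ⊢
    rw [inv_mul_lt_iff₀ hn] at hω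
    exact hω.le
  refine (measureReal_mono hsub).trans (hcher.trans ?_)
  rw [hind.mgf_sum hYm]
  calc _ ≤ Real.exp (- -t * (n * ((1 - η) * m))) *
        ∏ _i : Fin n, Real.exp (-(t * m) + t ^ 2 * (h * m) ^ 2 / 2) := by
        gcongr with i
        · exact fun i _ => mgf_nonneg
        · exact hmgf i
    _ = Real.exp (-(n * η ^ 2 / (2 * h ^ 2))) := by
        rw [Finset.prod_const, Finset.card_univ, Fintype.card_fin, ← Real.exp_nat_mul,
          ← Real.exp_add, ht]
        congr 1
        field_simp
        ring

/-- Polynomial concentration of an average of i.i.d. variables with a finite `q`-th moment. -/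
lemma measureReal_lt_abs_average_sub_le [IsProbabilityMeasure μ] {n : ℕ} [NeZero n]
    {Y : Fin n → Ω → ℝ} (hYm : ∀ i, Measurable (Y i)) (hind : iIndepFun Y μ)
    (hid : ∀ i, IdentDistrib (Y i) (Y 0) μ μ) {q hs ε : ℝ} (hq : 2 < q) (hhs : 1 < hs)
    (hε : 0 < ε) (hLq : MemLp (Y 0) (ENNReal.ofReal q) μ) (hm : 0 < ∫ ω, Y 0 ω ∂μ)
    (hmom : lpNorm (Y 0) (ENNReal.ofReal q) μ ≤ hs * ∫ ω, Y 0 ω ∂μ) :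
    μ.real {ω | ε * ∫ ω, Y 0 ω ∂μ < |(n : ℝ)⁻¹ * ∑ i, Y i ω - ∫ ω, Y 0 ω ∂μ|} ≤
      (2 * q * hs / (ε * √n)) ^ q := by
  set m := ∫ ω, Y 0 ω ∂μ with hmdef
  set P := ENNReal.ofReal q with hP
  have hq0 : 0 < q := by linarith
  have hP0 : P ≠ 0 := by simpa [hP] using hq0
  have hP1 : 1 ≤ P := by rw [hP]; exact ENNReal.one_le_ofReal.2 (by linarith)
  have hn : (0 : ℝ) < n := by exact_mod_cast Nat.pos_of_ne_zero (NeZero.ne n)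
  set Z : Fin n → Ω → ℝ := fun i ω => Y i ω - m with hZ
  have hYq : ∀ i, MemLp (Y i) P μ := fun i => (hid i).memLp_iff.2 hLq
  have hZq : ∀ i, MemLp (Z i) P μ := fun i => (hYq i).sub (memLp_const m)
  have hZ0 : ∀ i, ∫ ω, Z i ω ∂μ = 0 := fun i => by
    rw [hZ, integral_sub ((hYq i).integrable hP1) (integrable_const m), (hid i).integral_eq]
    simp [hmdef]
  have hYnorm : ∀ i, lpNorm (Y i) P μ ≤ hs * m := fun i => by
    rw [← toReal_eLpNorm (hYq i).aestronglyMeasurable, (hid i).eLpNorm_eq,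
      toReal_eLpNorm hLq.aestronglyMeasurable]
    exact hmom
  have hZnorm : ∀ i, lpNorm (Z i) P μ ≤ 2 * hs * m := fun i => by
    have h1 := lpNorm_sub_le (g := fun _ : Ω => m) (hYq i) hP1
    rw [lpNorm_const hP0 (IsProbabilityMeasure.ne_zero μ)] at h1
    simp only [probReal_univ, Real.one_rpow, mul_one, Real.norm_eq_abs, abs_of_pos hm] at h1
    have h2 : m ≤ hs * m := by nlinarith
    have h3 : lpNorm (Z i) P μ ≤ lpNorm (Y i) P μ + m := h1
    linarith [hYnorm i]
  have hZind : iIndepFun Z μ := hind.comp (fun _ t => t - m) fun _ => by fun_prop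
  have hsum := lpNorm_sum_sq_le hq (fun i => (hYm i).sub_const m) hZq hZind hZ0 hZnorm
    Finset.univ
  set W := ∑ i, Z i with hW
  have hWq : MemLp W P μ := memLp_finsetSum' _ fun i _ => hZq i
  have hWle : lpNorm W P μ ≤ √n * (2 * q * hs * m) := by
    refine le_of_sq_le_sq ?_ (by positivity)
    rw [mul_pow, Real.sq_sqrt hn.le]
    refine hsum.trans_eq ?_
    rw [Finset.card_univ, Fintype.card_fin]
    ring
  have hmk := mul_meas_ge_le_integral_of_nonneg (μ := μ) (f := fun ω => |W ω| ^ q)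
    (ae_of_all _ fun ω => Real.rpow_nonneg (abs_nonneg _) _) (integrable_abs_rpow hq0 hWq)
    ((n * (ε * m)) ^ q)
  rw [integral_abs_rpow_eq hq0 hWq.aestronglyMeasurable] at hmk
  have hpos : 0 < (n * (ε * m)) ^ q := by positivity
  have hsub : {ω | ε * m < |(n : ℝ)⁻¹ * ∑ i, Y i ω - m|} ⊆
      {ω | (n * (ε * m)) ^ q ≤ |W ω| ^ q} := by
    intro ω hω
    simp only [Set.mem_ofPred_eq] at hω ⊢
    refine Real.rpow_le_rpow (by positivity) ?_ hq0.le
    have e : W ω = n * ((n : ℝ)⁻¹ * ∑ i, Y i ω - m) := by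
      simp only [hW, hZ, Finset.sum_apply, Finset.sum_sub_distrib, Finset.sum_const,
        Finset.card_univ, Fintype.card_fin, nsmul_eq_mul]
      field_simp
    rw [e, abs_mul, abs_of_pos hn]
    gcongr
  refine (measureReal_mono hsub).trans ?_
  rw [← le_div_iff₀' hpos] at hmk
  refine hmk.trans ?_
  rw [← Real.div_rpow lpNorm_nonneg (by positivity)]
  refine Real.rpow_le_rpow (div_nonneg lpNorm_nonneg (by positivity)) ?_ hq0.le
  rw [div_le_div_iff₀ (by positivity) (by positivity)]
  calc lpNorm W P μ * (ε * √n) ≤ √n * (2 * q * hs * m) * (ε * √n) := by gcongr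
    _ = 2 * q * hs * ((√n * √n) * (ε * m)) := by ring
    _ = _ := by rw [Real.mul_self_sqrt hn.le]

lemma measureReal_mul_le_average_le [IsProbabilityMeasure μ] {n : ℕ} [NeZero n]
    {Y : Fin n → Ω → ℝ} (hid : ∀ i, IdentDistrib (Y i) (Y 0) μ μ) (hnn : ∀ i ω, 0 ≤ Y i ω)
    (hint : Integrable (Y 0) μ) (hm : 0 < ∫ ω, Y 0 ω ∂μ) {K : ℝ} (hK : 0 < K) :
    μ.real {ω | K * ∫ ω, Y 0 ω ∂μ ≤ (n : ℝ)⁻¹ * ∑ i, Y i ω} ≤ 1 / K := by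
  have hn : (0 : ℝ) < n := by exact_mod_cast Nat.pos_of_ne_zero (NeZero.ne n)
  have hi : ∀ i, Integrable (Y i) μ := fun i => (hid i).integrable_iff.2 hint
  have h1 := mul_meas_ge_le_integral_of_nonneg (μ := μ) (f := fun ω => (n : ℝ)⁻¹ * ∑ i, Y i ω)
    (ae_of_all _ fun ω => mul_nonneg (by positivity) (Finset.sum_nonneg fun i _ => hnn i ω))
    ((integrable_finsetSum _ fun i _ => hi i).const_mul _) (K * ∫ ω, Y 0 ω ∂μ)
  have h2 : ∫ ω, (n : ℝ)⁻¹ * ∑ i, Y i ω ∂μ = ∫ ω, Y 0 ω ∂μ := by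
    rw [integral_const_mul, integral_finsetSum _ fun i _ => hi i,
      Finset.sum_congr rfl fun i _ => (hid i).integral_eq]
    simp [hn.ne']
  rw [h2, mul_right_comm] at h1
  rw [le_div_iff₀ hK, mul_comm]
  exact (mul_le_iff_le_one_left hm).1 h1

end RestrictedEigenvalue

/-! ### From sums of atoms to all vectors -/

namespace RestrictedEigenvalue

variable {p : ℕ}

/-- The vector `± e_j / √(r B_jj)` with `r` between `1` and `K`. Finitely many of these vectors
serve for every sample: up to a factor two, the data-dependent scale `√(A_jj)` of the `j`-th
coordinate is one of the scales `√(r B_jj)`. -/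
noncomputable def atom (B : Matrix (Fin p) (Fin p) ℝ) (K : ℕ) (a : Fin p × Fin K × SignType) :
    Fin p → ℝ :=
  Pi.single a.1 ((a.2.2 : ℝ) / √(((a.2.1 : ℕ) + 1) * B a.1 a.1))

lemma l0Norm_sum_atom_le (B : Matrix (Fin p) (Fin p) ℝ) {K d : ℕ}
    (f : Fin d → Fin p × Fin K × SignType) : l0Norm (∑ k, atom B K (f k)) ≤ d := by
  have hsub : (Finset.univ.filter fun j => (∑ k, atom B K (f k)) j ≠ 0) ⊆
      Finset.univ.image fun k => (f k).1 := by
    intro j hj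
    rw [Finset.mem_filter, Finset.sum_apply] at hj
    obtain ⟨k, -, hk⟩ := Finset.exists_ne_zero_of_sum_ne_zero hj.2
    refine Finset.mem_image.2 ⟨k, Finset.mem_univ k, ?_⟩
    by_contra hne
    exact hk (by simp [atom, Pi.single_eq_of_ne (Ne.symm hne)])
  refine (Finset.card_le_card hsub).trans (Finset.card_image_le.trans ?_)
  simp

lemma single_quadratic (A : Matrix (Fin p) (Fin p) ℝ) (j : Fin p) (c : ℝ) :
    (Pi.single j c) ⬝ᵥ (A *ᵥ Pi.single j c) = c ^ 2 * A j j := by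
  simp [single_dotProduct]
  ring

lemma smul_quadratic (A : Matrix (Fin p) (Fin p) ℝ) (c : ℝ) (v : Fin p → ℝ) :
    (c • v) ⬝ᵥ (A *ᵥ (c • v)) = c ^ 2 * (v ⬝ᵥ (A *ᵥ v)) := by
  simp [Matrix.mulVec_smul]
  ring

/-- Transfer from a finite family of sparse vectors to all vectors, by Maurey's method. -/
lemma quadratic_lower_bound_of_atoms {A B : Matrix (Fin p) (Fin p) ℝ} {K d : ℕ} {η : ℝ}
    (hK0 : 0 < K) (hd : 2 ≤ d) (hη : η ≤ 1 / 2)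
    (hA : ∀ j, 0 ≤ A j j) (hnn : ∀ j, 0 ≤ B j j)
    (hB : ∀ j k, B j j = 0 → B j k = 0 ∧ B k j = 0)
    (hAB : ∀ j k, B j j = 0 → A j k = 0 ∧ A k j = 0)
    (hK : ∀ j, 0 < B j j → A j j < K * B j j)
    (hT : ∀ f : Fin d → Fin p × Fin K × SignType,
      (1 - η) * ((∑ k, atom B K (f k)) ⬝ᵥ (B *ᵥ ∑ k, atom B K (f k))) ≤
        (∑ k, atom B K (f k)) ⬝ᵥ (A *ᵥ ∑ k, atom B K (f k))) :
    (∀ j, (1 - η) * B j j ≤ A j j) ∧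
    ∀ x : Fin p → ℝ, (1 - η) * (x ⬝ᵥ (B *ᵥ x)) - 2 / (d - 1) * (∑ j, √(A j j) * |x j|) ^ 2 ≤
      x ⬝ᵥ (A *ᵥ x) := by
  have hd0 : (2 : ℝ) ≤ d := by exact_mod_cast hd
  -- a constant tuple of atoms compares the diagonals
  have hlow : ∀ j, (1 - η) * B j j ≤ A j j := by
    intro j
    rcases (hnn j).eq_or_lt with h0 | hpos
    · rw [← h0, mul_zero]; exact hA j
    have h1 := hT fun _ => (j, ⟨0, hK0⟩, 1)
    have h2 : ∑ _k : Fin d, atom B K (j, ⟨0, hK0⟩, 1) = Pi.single j (d / √(B j j)) := by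
      rw [Finset.sum_const, Finset.card_univ, Fintype.card_fin, atom, ← Pi.single_smul]
      congr 1
      simp [div_eq_mul_inv]
    rw [h2, single_quadratic, single_quadratic, mul_left_comm] at h1
    have : 0 < √(B j j) := Real.sqrt_pos.2 hpos
    exact le_of_mul_le_mul_left h1 (by positivity)
  refine ⟨hlow, fun x => ?_⟩
  have hr : ∀ j, ∃ r : Fin K, A j j ≤ ((r : ℕ) + 1) * B j j ∧
      ((r : ℕ) + 1) * B j j ≤ A j j + B j j := by
    intro j
    rcases (hnn j).eq_or_lt with h0 | hpos
    · exact ⟨⟨0, hK0⟩, by simp [← h0, (hAB j j h0.symm).1]⟩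
    · refine ⟨⟨⌊A j j / B j j⌋₊, ?_⟩, ?_, ?_⟩
      · rw [Nat.floor_lt (div_nonneg (hA j) hpos.le), div_lt_iff₀ hpos]
        exact hK j hpos
      · rw [← div_le_iff₀ hpos]
        exact (Nat.lt_floor_add_one _).le
      · have := (le_div_iff₀ hpos).1 (Nat.floor_le (div_nonneg (hA j) hpos.le))
        rw [add_mul, one_mul]
        simpa using this
  choose r hr1 hr2 using hr
  set R : Fin p → ℝ := fun j => ((r j : ℕ) + 1) * B j j with hR
  have hR0 : ∀ j, 0 ≤ R j := fun j => (hA j).trans (hr1 j)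
  set a : Fin p → Fin p × Fin K × SignType := fun j => (j, r j, SignType.sign (x j)) with ha
  have hatom : ∀ j, atom B K (a j) = Pi.single j ((SignType.sign (x j) : ℝ) / √(R j)) :=
    fun j => rfl
  set l : Fin p → ℝ := fun j => |x j| * √(R j) with hl
  have hl0 : ∀ j, 0 ≤ l j := fun j => by positivity
  set Λ := ∑ j, l j with hΛ
  set L := ∑ j, √(A j j) * |x j| with hL
  have hL0 : 0 ≤ L := Finset.sum_nonneg fun j _ => by positivity
  have hΛL : Λ ≤ 2 * L := by
    rw [hΛ, hL, Finset.mul_sum]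
    refine Finset.sum_le_sum fun j _ => ?_
    have h1 : √(R j) ≤ 2 * √(A j j) := by
      rw [show (2 : ℝ) * √(A j j) = √(4 * A j j) by
        rw [Real.sqrt_mul (by norm_num), show (4 : ℝ) = 2 ^ 2 by norm_num,
          Real.sqrt_sq (by norm_num)]]
      refine Real.sqrt_le_sqrt ((hr2 j).trans ?_)
      nlinarith [hlow j, hnn j]
    calc l j ≤ |x j| * (2 * √(A j j)) := by simp only [hl]; gcongr
      _ = _ := by ring
  -- `y` drops the coordinates of `x` on which both quadratic forms vanish
  set y := ∑ j, l j • atom B K (a j) with hy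
  have hyj : ∀ j, B j j ≠ 0 → y j = x j := by
    intro j hj
    have hRj : 0 < R j := mul_pos (by positivity) ((hnn j).lt_of_ne' hj)
    rw [hy, Finset.sum_apply, Finset.sum_eq_single j]
    · rw [Pi.smul_apply, hatom, Pi.single_eq_same, smul_eq_mul]
      have : √(R j) ≠ 0 := (Real.sqrt_pos.2 hRj).ne'
      simp only [hl]
      field_simp
      exact abs_mul_sign (x j)
    · intro k _ hk
      rw [Pi.smul_apply, hatom, Pi.single_eq_of_ne (Ne.symm hk), smul_zero]
    · simp
  have hquad : ∀ C : Matrix (Fin p) (Fin p) ℝ,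
      (∀ j k, B j j = 0 → C j k = 0 ∧ C k j = 0) → y ⬝ᵥ (C *ᵥ y) = x ⬝ᵥ (C *ᵥ x) := by
    intro C hC
    simp only [dotProduct, Matrix.mulVec, Finset.mul_sum]
    refine Finset.sum_congr rfl fun j _ => Finset.sum_congr rfl fun k _ => ?_
    by_cases hj : B j j = 0
    · simp [(hC j k hj).1]
    by_cases hk : B k k = 0
    · simp [(hC k j hk).2]
    rw [hyj j hj, hyj k hk]
  set Q := A - (1 - η) • B with hQ
  have hQv : ∀ v : Fin p → ℝ, v ⬝ᵥ (Q *ᵥ v) = v ⬝ᵥ (A *ᵥ v) - (1 - η) * (v ⬝ᵥ (B *ᵥ v)) := by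
    intro v
    rw [hQ, Matrix.sub_mulVec, Matrix.smul_mulVec, dotProduct_sub, dotProduct_smul, smul_eq_mul]
  suffices hmain : 0 ≤ (d - 1) * (y ⬝ᵥ (Q *ᵥ y)) + 2 * L ^ 2 by
    rw [← hquad A hAB, ← hquad B hB]
    rw [hQv] at hmain
    have hd1 : (0 : ℝ) < d - 1 := by linarith
    rw [div_mul_eq_mul_div, sub_le_iff_le_add', ← sub_le_iff_le_add, le_div_iff₀ hd1]
    linarith
  rcases (Finset.sum_nonneg fun j _ => hl0 j : 0 ≤ ∑ j, l j).eq_or_lt with h0 | hΛpos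
  · have hz : ∀ j, l j = 0 := fun j =>
      (Finset.sum_eq_zero_iff_of_nonneg fun j _ => hl0 j).1 h0.symm j (Finset.mem_univ j)
    have hy0 : y = 0 := by simp [hy, hz]
    rw [hy0]
    simp only [Matrix.mulVec_zero, dotProduct_zero, mul_zero, zero_add]
    positivity
  have hw1 : ∑ j, l j / Λ = 1 := by rw [← Finset.sum_div]; exact div_self hΛpos.ne'
  obtain ⟨f, hf⟩ := exists_quadratic_sum_le Q (w := fun j => l j / Λ)
    (fun j => div_nonneg (hl0 j) hΛpos.le) hw1 (fun j => Λ • atom B K (a j)) d 0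
  have e1 : ∑ j, (l j / Λ) • Λ • atom B K (a j) = y := by
    refine Finset.sum_congr rfl fun j _ => ?_
    rw [smul_smul, div_mul_cancel₀ _ hΛpos.ne']
  simp only [zero_add, e1, ← Finset.smul_sum, smul_quadratic] at hf
  have h1 : 0 ≤ Λ ^ 2 * ((∑ k, atom B K (a (f k))) ⬝ᵥ (Q *ᵥ ∑ k, atom B K (a (f k)))) := by
    rw [hQv]
    exact mul_nonneg (sq_nonneg _) (sub_nonneg.2 (hT fun k => a (f k)))
  have h2 : ∑ j, l j / Λ * (Λ ^ 2 * (atom B K (a j) ⬝ᵥ (Q *ᵥ atom B K (a j)))) ≤ 2 * L ^ 2 := by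
    have h3 : ∀ j, l j / Λ * (Λ ^ 2 * (atom B K (a j) ⬝ᵥ (Q *ᵥ atom B K (a j)))) ≤
        Λ * (√(A j j) * |x j|) := by
      intro j
      have h4 : l j * (atom B K (a j) ⬝ᵥ (Q *ᵥ atom B K (a j))) ≤ √(A j j) * |x j| := by
        rw [hatom, single_quadratic]
        rcases (hR0 j).eq_or_lt with hRz | hRpos
        · simp only [hl, ← hRz, Real.sqrt_zero, mul_zero, zero_mul]
          positivity
        have hs1 : (SignType.sign (x j) : ℝ) ^ 2 ≤ 1 := by
          rcases lt_trichotomy (x j) 0 with h | h | h <;> simp [h, sign_neg, sign_pos]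
        have hs : 0 < √(R j) := Real.sqrt_pos.2 hRpos
        have hQj : Q j j ≤ √(A j j) * √(R j) := by
          have e2 : Q j j = A j j - (1 - η) * B j j := by simp [hQ]
          have e3 : A j j = √(A j j) * √(A j j) := (Real.mul_self_sqrt (hA j)).symm
          have e4 : √(A j j) * √(A j j) ≤ √(A j j) * √(R j) := by
            gcongr
            exact hr1 j
          have e5 : 0 ≤ (1 - η) * B j j := mul_nonneg (by linarith) (hnn j)
          linarith
        have hc : 0 ≤ l j * ((SignType.sign (x j) : ℝ) / √(R j)) ^ 2 := by
          have := hl0 j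
          positivity
        calc l j * (((SignType.sign (x j) : ℝ) / √(R j)) ^ 2 * Q j j)
            = l j * ((SignType.sign (x j) : ℝ) / √(R j)) ^ 2 * Q j j := by ring
          _ ≤ l j * ((SignType.sign (x j) : ℝ) / √(R j)) ^ 2 * (√(A j j) * √(R j)) := by gcongr
          _ = (SignType.sign (x j) : ℝ) ^ 2 * (√(A j j) * |x j|) := by
              simp only [hl]
              field_simp
          _ ≤ 1 * (√(A j j) * |x j|) := by gcongr
          _ = _ := one_mul _
      calc l j / Λ * (Λ ^ 2 * (atom B K (a j) ⬝ᵥ (Q *ᵥ atom B K (a j))))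
          = Λ * (l j * (atom B K (a j) ⬝ᵥ (Q *ᵥ atom B K (a j)))) := by
            have : Λ ≠ 0 := hΛpos.ne'
            field_simp
        _ ≤ _ := by gcongr
    calc _ ≤ ∑ j, Λ * (√(A j j) * |x j|) := Finset.sum_le_sum fun j _ => h3 j
      _ = Λ * L := by rw [← Finset.mul_sum]
      _ ≤ 2 * L * L := by gcongr
      _ = _ := by ring
  have hdpos : (0 : ℝ) < d := by linarith
  have h5 : 0 ≤ d * ((d - 1) * (y ⬝ᵥ (Q *ᵥ y)) + 2 * L ^ 2) := by
    have h6 := mul_le_mul_of_nonneg_left h2 hdpos.le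
    nlinarith
  exact nonneg_of_mul_nonneg_right h5 hdpos

/-- The sample size makes the union bound over `d`-tuples of atoms work. -/
lemma card_pow_mul_exp_le {n p : ℕ} {δ ε h M : ℝ} (hp : 2 ≤ p) (hδ : 0 < δ) (hδ' : δ < 1 / 2)
    (hε : 0 < ε) (hε' : ε < 1 / 2) (hh : 1 < h) (hM : 1 ≤ M)
    (hn : 784 * h ^ 2 * M * (1 + 2 * Real.log (p / (4 * δ))) / ε ^ 4 ≤ n) :
    ⌈4 * M / ε⌉₊ + 1 ≤ n ∧
      ((p * (⌈3 * p / δ⌉₊ * 3) : ℕ) : ℝ) ^ (⌈4 * M / ε⌉₊ + 1) *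
        Real.exp (-(n * (ε / 2) ^ 2 / (2 * h ^ 2))) ≤ δ / 3 := by
  have hp2 : (2 : ℝ) ≤ p := by exact_mod_cast hp
  set z := (p : ℝ) / (4 * δ) with hz
  have hz1 : 1 ≤ z := by
    rw [hz, le_div_iff₀ (by positivity)]
    linarith
  set L := Real.log z with hL
  have hL0 : 0 ≤ L := Real.log_nonneg hz1
  set d := ⌈4 * M / ε⌉₊ + 1 with hd
  have hMε : 2 ≤ M / ε := by
    rw [le_div_iff₀ hε]; linarith
  have hd5 : (d : ℝ) ≤ 5 * (M / ε) := by
    have h1 := Nat.ceil_lt_add_one (by positivity : 0 ≤ 4 * M / ε)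
    have h2 : 4 * M / ε = 4 * (M / ε) := by ring
    rw [hd]
    push_cast
    linarith
  have hd1 : (1 : ℝ) ≤ d := by rw [hd]; push_cast; linarith [Nat.cast_nonneg (α := ℝ) ⌈4 * M / ε⌉₊]
  have hh2 : 1 ≤ h ^ 2 := by nlinarith
  have hε3 : 8 ≤ 1 / ε ^ 3 := by
    rw [le_div_iff₀ (by positivity)]
    have : ε ^ 3 ≤ (1 / 2) ^ 3 := pow_le_pow_left₀ hε.le hε'.le 3
    linarith
  have hn' : 784 * h ^ 2 * (M / ε) * (1 + 2 * L) * (1 / ε ^ 3) ≤ n := by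
    refine le_trans (le_of_eq ?_) hn
    field_simp
  have hMεL : M / ε ≤ (M / ε) * (1 + 2 * L) := by nlinarith
  constructor
  · have h1 : (d : ℝ) ≤ n := by
      calc (d : ℝ) ≤ 784 * 1 * (M / ε) * 1 * 8 := by linarith
        _ ≤ 784 * h ^ 2 * (M / ε) * (1 + 2 * L) * (1 / ε ^ 3) := by
            gcongr
            linarith
        _ ≤ n := hn'
    exact_mod_cast h1
  -- the cardinality of the set of atoms is at most `96 z²`
  set N := p * (⌈3 * p / δ⌉₊ * 3) with hN
  have hK : (⌈3 * p / δ⌉₊ : ℝ) ≤ 16 * z := by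
    have h1 := Nat.ceil_lt_add_one (by positivity : 0 ≤ 3 * (p : ℝ) / δ)
    have h2 : 3 * (p : ℝ) / δ = 12 * z := by rw [hz]; field_simp; norm_num
    linarith
  have hpz : (p : ℝ) ≤ 2 * z := by
    rw [hz, ← mul_div_assoc, le_div_iff₀ (by positivity)]
    nlinarith
  have hNz : (N : ℝ) ≤ 96 * z ^ 2 := by
    rw [hN]
    push_cast
    calc (p : ℝ) * (⌈3 * p / δ⌉₊ * 3) ≤ 2 * z * (16 * z * 3) := by gcongr
      _ = _ := by ring
  have hz0 : 0 < z := by linarith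
  have hexp5 : (96 : ℝ) ≤ Real.exp 5 := by
    have h1 := Real.exp_one_gt_d9
    have h2 : Real.exp 5 = Real.exp 1 ^ 5 := by rw [← Real.exp_nat_mul]; norm_num
    rw [h2]
    calc (96 : ℝ) ≤ 2.7 ^ 5 := by norm_num
      _ ≤ _ := by gcongr; linarith
  have hNe : (N : ℝ) ≤ Real.exp (5 + 2 * L) := by
    have h1 : Real.exp (2 * L) = z ^ 2 := by
      rw [two_mul, Real.exp_add, hL, Real.exp_log hz0, sq]
    rw [Real.exp_add, h1]
    exact hNz.trans (by gcongr)
  have hδe : Real.exp (-(2 + L)) ≤ δ / 3 := by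
    rw [Real.exp_neg, inv_le_comm₀ (Real.exp_pos _) (by positivity), Real.exp_add, hL,
      Real.exp_log hz0]
    have h1 : (6 : ℝ) ≤ Real.exp 2 := by
      have h1 := Real.exp_one_gt_d9
      have h2 : Real.exp 2 = Real.exp 1 ^ 2 := by rw [← Real.exp_nat_mul]; norm_num
      rw [h2]
      nlinarith
    calc (δ / 3)⁻¹ = 6 * (2 / (4 * δ)) := by field_simp; norm_num
      _ ≤ Real.exp 2 * z := by rw [hz]; gcongr
  refine le_trans ?_ hδe
  calc (N : ℝ) ^ d * Real.exp (-(n * (ε / 2) ^ 2 / (2 * h ^ 2)))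
      ≤ Real.exp (5 + 2 * L) ^ d * Real.exp (-(n * (ε / 2) ^ 2 / (2 * h ^ 2))) := by gcongr
    _ = Real.exp (d * (5 + 2 * L) + -(n * (ε / 2) ^ 2 / (2 * h ^ 2))) := by
        rw [← Real.exp_nat_mul, ← Real.exp_add]
    _ ≤ _ := by
        apply Real.exp_le_exp.2
        have h1 : 98 * ((M / ε) * (1 + 2 * L)) ≤ n * (ε / 2) ^ 2 / (2 * h ^ 2) := by
          rw [le_div_iff₀ (by positivity)]
          have h2 : 1 ≤ 1 / ε := by rw [le_div_iff₀ hε]; linarith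
          calc 98 * ((M / ε) * (1 + 2 * L)) * (2 * h ^ 2)
              = 784 * h ^ 2 * (M / ε) * (1 + 2 * L) * 1 * (1 / 4) := by ring
            _ ≤ 784 * h ^ 2 * (M / ε) * (1 + 2 * L) * (1 / ε) * (1 / 4) := by gcongr
            _ = 784 * h ^ 2 * (M / ε) * (1 + 2 * L) * (1 / ε ^ 3) * (ε / 2) ^ 2 := by
                field_simp; norm_num
            _ ≤ n * (ε / 2) ^ 2 := by gcongr
        have h3 : d * (5 + 2 * L) + (2 + L) ≤ d * (7 * (1 + 2 * L)) := by nlinarith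
        have h4 : d * (7 * (1 + 2 * L)) ≤ 5 * (M / ε) * (7 * (1 + 2 * L)) := by gcongr
        nlinarith [mul_nonneg (by linarith : (0 : ℝ) ≤ M / ε) (by linarith : 0 ≤ 1 + 2 * L)]

end RestrictedEigenvalue

/-! ### Second moment matrices and the exceptional events -/

namespace RestrictedEigenvalue

variable {Ω : Type*} [MeasurableSpace Ω] {μ : Measure Ω} {n p : ℕ}

lemma sampleSecondMoment_apply (x : Fin n → Fin p → ℝ) (j k : Fin p) :
    sampleSecondMoment x j k = (n : ℝ)⁻¹ * ∑ i, x i j * x i k := by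
  simp [sampleSecondMoment, Matrix.sum_apply, Matrix.vecMulVec_apply]

lemma dotProduct_sampleSecondMoment_mulVec (x : Fin n → Fin p → ℝ) (v : Fin p → ℝ) :
    v ⬝ᵥ (sampleSecondMoment x *ᵥ v) = (n : ℝ)⁻¹ * ∑ i, (v ⬝ᵥ x i) ^ 2 := by
  rw [sampleSecondMoment, Matrix.smul_mulVec, dotProduct_smul, smul_eq_mul, Matrix.sum_mulVec,
    dotProduct_sum]
  congr 1
  refine Finset.sum_congr rfl fun i _ => ?_
  rw [Matrix.vecMulVec_mulVec, dotProduct_smul, dotProduct_comm (x i) v]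
  simp [sq]

lemma dotProduct_secondMoment_mulVec {Y : Ω → Fin p → ℝ}
    (hY : ∀ j, MemLp (fun ω => Y ω j) 2 μ) (v : Fin p → ℝ) :
    v ⬝ᵥ (secondMoment μ Y *ᵥ v) = ∫ ω, (v ⬝ᵥ Y ω) ^ 2 ∂μ := by
  have hi : ∀ j k, Integrable (fun ω => v j * (Y ω j * Y ω k * v k)) μ := fun j k =>
    (((hY j).integrable_mul (hY k)).mul_const _).const_mul _
  have e : ∀ ω, (v ⬝ᵥ Y ω) ^ 2 = ∑ j, ∑ k, v j * (Y ω j * Y ω k * v k) := fun ω => by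
    rw [sq, dotProduct, Finset.sum_mul_sum]
    exact Finset.sum_congr rfl fun j _ => Finset.sum_congr rfl fun k _ => by ring
  simp_rw [e]
  rw [integral_finsetSum _ fun j _ => integrable_finsetSum _ fun k _ => hi j k]
  simp only [dotProduct, Matrix.mulVec, secondMoment, Matrix.of_apply, Finset.mul_sum]
  refine Finset.sum_congr rfl fun j _ => ?_
  rw [integral_finsetSum _ fun k _ => hi j k]
  refine Finset.sum_congr rfl fun k _ => ?_
  rw [integral_const_mul, integral_mul_const]

lemma secondMoment_apply_self (Y : Ω → Fin p → ℝ) (j : Fin p) :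
    secondMoment μ Y j j = ∫ ω, Y ω j ^ 2 ∂μ := by
  simp [secondMoment, sq]

lemma secondMoment_apply_self_nonneg (Y : Ω → Fin p → ℝ) (j : Fin p) :
    0 ≤ secondMoment μ Y j j := by
  rw [secondMoment_apply_self]
  exact integral_nonneg fun _ => sq_nonneg _

lemma ae_eq_zero_of_secondMoment_eq_zero {Y : Ω → Fin p → ℝ} {j : Fin p}
    (hY : MemLp (fun ω => Y ω j) 2 μ) (h : secondMoment μ Y j j = 0) :
    ∀ᵐ ω ∂μ, Y ω j = 0 := by
  rw [secondMoment_apply_self] at h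
  have := (integral_eq_zero_iff_of_nonneg (fun ω => sq_nonneg (Y ω j)) hY.integrable_sq).1 h
  filter_upwards [this] with ω hω
  simpa using hω

lemma secondMoment_eq_zero_of_diag {Y : Ω → Fin p → ℝ}
    (hY : ∀ j, MemLp (fun ω => Y ω j) 2 μ) (j k : Fin p) (h : secondMoment μ Y j j = 0) :
    secondMoment μ Y j k = 0 ∧ secondMoment μ Y k j = 0 := by
  have := ae_eq_zero_of_secondMoment_eq_zero (hY j) h
  constructor
  · rw [secondMoment, Matrix.of_apply]
    refine integral_eq_zero_of_ae ?_
    filter_upwards [this] with ω hω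
    simp [hω]
  · rw [secondMoment, Matrix.of_apply]
    refine integral_eq_zero_of_ae ?_
    filter_upwards [this] with ω hω
    simp [hω]

section Events

variable [IsProbabilityMeasure μ] [NeZero n] {X : Fin n → Ω → Fin p → ℝ}

/-- The diagonal of the sample second moment matrix is accurate on a set of `s` coordinates. -/
lemma measureReal_diag_deviation_le (hX_meas : ∀ i, Measurable (X i)) (hX_indep : iIndepFun X μ)
    (hX_ident : ∀ i, IdentDistrib (X i) (X 0) μ μ) {q : ℝ} (hq : 2 < q)
    (hX_moment : ∀ j, MemLp (fun ω => X 0 ω j) (ENNReal.ofReal (2 * q)) μ)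
    {hstar : ℝ} (hhstar : 1 < hstar)
    (h_coord : ∀ j : Fin p,
      (∫ ω, |X 0 ω j| ^ (2 * q) ∂μ) ^ (1 / q) ≤ hstar * ∫ ω, X 0 ω j ^ 2 ∂μ)
    {δ ε : ℝ} (hδ : 0 < δ) (hε : 0 < ε) {S : Finset (Fin p)}
    (hpos : ∀ j ∈ S, 0 < ∫ ω, X 0 ω j ^ 2 ∂μ)
    (hn : 4 * q ^ 2 * hstar ^ 2 * (3 : ℝ) ^ (2 / q) * (S.card : ℝ) ^ (2 / q) /
      (ε ^ 2 * δ ^ (2 / q)) ≤ n) :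
    μ.real (⋃ j ∈ S, {ω | ε * ∫ ω, X 0 ω j ^ 2 ∂μ <
      |(n : ℝ)⁻¹ * ∑ i, X i ω j ^ 2 - ∫ ω, X 0 ω j ^ 2 ∂μ|}) ≤ δ / 3 := by
  have hq0 : 0 < q := by linarith
  have hn0 : (0 : ℝ) < n := by exact_mod_cast Nat.pos_of_ne_zero (NeZero.ne n)
  rcases S.eq_empty_or_nonempty with rfl | hS
  · simp; positivity
  have hs : (0 : ℝ) < S.card := by exact_mod_cast hS.card_pos
  have hone : ∀ j ∈ S, μ.real {ω | ε * ∫ ω, X 0 ω j ^ 2 ∂μ <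
      |(n : ℝ)⁻¹ * ∑ i, X i ω j ^ 2 - ∫ ω, X 0 ω j ^ 2 ∂μ|} ≤
      (2 * q * hstar / (ε * √n)) ^ q := by
    intro j hj
    have hg : Measurable fun v : Fin p → ℝ => v j ^ 2 := by fun_prop
    have hLq : MemLp (fun ω => X 0 ω j ^ 2) (ENNReal.ofReal q) μ := by
      have h1 := (hX_moment j).norm_rpow_div (2 : ENNReal)
      have e : ENNReal.ofReal (2 * q) / 2 = ENNReal.ofReal q := by
        rw [← ENNReal.ofReal_ofNat 2, ← ENNReal.ofReal_div_of_pos (by norm_num)]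
        congr 1; ring
      rw [e] at h1
      refine h1.congr_norm ?_ (ae_of_all _ fun ω => ?_)
      · exact (hX_moment j).aestronglyMeasurable.pow 2
      · simp
    refine measureReal_lt_abs_average_sub_le (Y := fun i ω => X i ω j ^ 2)
      (fun i => hg.comp (hX_meas i)) (hX_indep.comp (fun _ v => v j ^ 2) fun _ => hg)
      (fun i => (hX_ident i).comp hg) hq hhstar hε hLq (hpos j hj) ?_
    refine le_trans (le_of_eq ?_) (h_coord j)
    have e1 : ∀ ω, |X 0 ω j| ^ (2 * q) = |X 0 ω j ^ 2| ^ q := fun ω => by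
      rw [abs_pow, ← Real.rpow_natCast, ← Real.rpow_mul (abs_nonneg _)]
      norm_num
    simp_rw [e1]
    rw [integral_abs_rpow_eq hq0 hLq.aestronglyMeasurable, ← Real.rpow_mul lpNorm_nonneg,
      mul_one_div_cancel hq0.ne', Real.rpow_one]
  have hnum : (S.card : ℝ) * (2 * q * hstar / (ε * √n)) ^ q ≤ δ / 3 := by
    set u := 2 * q * hstar / (ε * √n) with hu
    have hu0 : 0 ≤ u := by positivity
    have h1 : u ^ 2 ≤ (δ / (3 * S.card)) ^ (2 / q) := by
      rw [Real.div_rpow hδ.le (by positivity), Real.mul_rpow (by norm_num) hs.le, hu, div_pow,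
        mul_pow ε, Real.sq_sqrt hn0.le, div_le_div_iff₀ (by positivity) (by positivity)]
      rw [div_le_iff₀ (by positivity)] at hn
      linarith
    have h2 : u ^ q ≤ δ / (3 * S.card) := by
      have e : u ^ q = (u ^ 2) ^ (q / 2) := by
        rw [← Real.rpow_natCast, ← Real.rpow_mul hu0]
        congr 1; push_cast; ring
      have e2 : δ / (3 * S.card) = ((δ / (3 * S.card)) ^ (2 / q)) ^ (q / 2) := by
        rw [← Real.rpow_mul (by positivity)]
        have : 2 / q * (q / 2) = 1 := by field_simp
        rw [this, Real.rpow_one]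
      rw [e, e2]
      exact Real.rpow_le_rpow (by positivity) h1 (by positivity)
    calc (S.card : ℝ) * u ^ q ≤ S.card * (δ / (3 * S.card)) := by gcongr
      _ = δ / 3 := by field_simp
  refine (measureReal_biUnion_finset_le S _).trans ((Finset.sum_le_sum hone).trans ?_)
  simpa using hnum

/-- The diagonal of the sample second moment matrix is nowhere excessively large. -/
lemma measureReal_diag_large_le (hX_ident : ∀ i, IdentDistrib (X i) (X 0) μ μ)
    (hL2 : ∀ j, MemLp (fun ω => X 0 ω j) 2 μ) {K : ℝ} (hK : 0 < K) {T : Finset (Fin p)}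
    (hT : ∀ j ∈ T, 0 < ∫ ω, X 0 ω j ^ 2 ∂μ) :
    μ.real (⋃ j ∈ T, {ω | K * ∫ ω, X 0 ω j ^ 2 ∂μ ≤ (n : ℝ)⁻¹ * ∑ i, X i ω j ^ 2}) ≤ p / K := by
  refine (measureReal_biUnion_finset_le T _).trans ?_
  calc _ ≤ ∑ _j ∈ T, 1 / K := by
        refine Finset.sum_le_sum fun j hj => ?_
        have hg : Measurable fun v : Fin p → ℝ => v j ^ 2 := by fun_prop
        exact measureReal_mul_le_average_le (Y := fun i ω => X i ω j ^ 2)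
          (fun i => (hX_ident i).comp hg) (fun _ _ => sq_nonneg _) (hL2 j).integrable_sq
          (hT j hj) hK
    _ = T.card / K := by simp [div_eq_mul_inv]
    _ ≤ p / K := by
        gcongr
        simpa using T.card_le_univ

/-- Simultaneous lower tail for a finite family of sparse directions. -/
lemma measureReal_iUnion_quadratic_lt_le {ι : Type*} [Fintype ι]
    (hX_meas : ∀ i, Measurable (X i)) (hX_indep : iIndepFun X μ)
    (hX_ident : ∀ i, IdentDistrib (X i) (X 0) μ μ)
    (hL4 : ∀ j, MemLp (fun ω => X 0 ω j) 4 μ) {h η : ℝ} (hh : 0 < h) (hη : 0 ≤ η)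
    (w : ι → Fin p → ℝ)
    (hw : ∀ a, √(∫ ω, (w a ⬝ᵥ X 0 ω) ^ 4 ∂μ) ≤ h * ∫ ω, (w a ⬝ᵥ X 0 ω) ^ 2 ∂μ) :
    μ.real (⋃ a, {ω | (n : ℝ)⁻¹ * ∑ i, (w a ⬝ᵥ X i ω) ^ 2 <
      (1 - η) * ∫ ω, (w a ⬝ᵥ X 0 ω) ^ 2 ∂μ}) ≤
      Fintype.card ι * Real.exp (-(n * η ^ 2 / (2 * h ^ 2))) := by
  refine (measureReal_iUnion_fintype_le _).trans ?_
  calc _ ≤ ∑ _a : ι, Real.exp (-(n * η ^ 2 / (2 * h ^ 2))) := by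
        refine Finset.sum_le_sum fun a _ => ?_
        have hg : Measurable fun v : Fin p → ℝ => (w a ⬝ᵥ v) ^ 2 := by
          unfold dotProduct; fun_prop
        have hdot : MemLp (fun ω => w a ⬝ᵥ X 0 ω) 4 μ :=
          memLp_finsetSum _ fun j _ => (hL4 j).const_mul (w a j)
        have hL2 : MemLp (fun ω => (w a ⬝ᵥ X 0 ω) ^ 2) 2 μ := by
          have h1 := hdot.norm_rpow_div (2 : ENNReal)
          have e : (4 : ENNReal) / 2 = 2 := by
            exact ((ENNReal.eq_div_iff (by norm_num) (by norm_num)).2 (by norm_num)).symm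
          rw [e] at h1
          refine h1.congr_norm (hdot.aestronglyMeasurable.pow 2) (ae_of_all _ fun ω => ?_)
          simp
        refine measureReal_average_lt_le (Y := fun i ω => (w a ⬝ᵥ X i ω) ^ 2)
          (fun i => hg.comp (hX_meas i)) (hX_indep.comp (fun _ v => (w a ⬝ᵥ v) ^ 2) fun _ => hg)
          (fun i => (hX_ident i).comp hg) (fun _ _ => sq_nonneg _) hL2 hh hη ?_
        simpa only [← pow_mul] using hw a
    _ = _ := by simp

end Events

end RestrictedEigenvalue

/-! ### The lower bound on the cone -/

namespace RestrictedEigenvalue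

/-- In dimension one the accuracy of the single diagonal entry is all that is needed. -/
lemma one_dim_quadratic_le {A B : Matrix (Fin 1) (Fin 1) ℝ} {c : ℝ} (h : c * B 0 0 ≤ A 0 0)
    (x : Fin 1 → ℝ) : c * (x ⬝ᵥ (B *ᵥ x)) ≤ x ⬝ᵥ (A *ᵥ x) := by
  simp only [dotProduct, Matrix.mulVec, Fin.sum_univ_one]
  nlinarith [mul_le_mul_of_nonneg_left h (mul_self_nonneg (x 0))]

/-- What control of the diagonal and of the sums of atoms implies for the quadratic form on the
cone. Half of the allowed loss `ε` is spent on the sums of atoms, the other half on the error of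
Maurey's method, which the cone condition bounds by `2 M / (d - 1)` times the population form. -/
lemma quadratic_lower_bound_on_cone {p : ℕ} {A B : Matrix (Fin p) (Fin p) ℝ} {K d : ℕ}
    {S : Finset (Fin p)} {α ε M : ℝ}
    (hα : 0 < α) (hε : 0 < ε) (hε' : ε < 1 / 2)
    (hre : 0 < re (normalized B) S (α * √((1 + ε) / (1 - ε))))
    (hM : M = (1 + ε) * (1 + α) ^ 2 * S.card /
      re (normalized B) S (α * √((1 + ε) / (1 - ε))) ^ 2)
    (hK0 : 0 < K) (hM1 : 1 ≤ M) (hd : 4 * M / ε + 1 ≤ d)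
    (hA : ∀ j, 0 ≤ A j j) (hnn : ∀ j, 0 ≤ B j j)
    (hB : ∀ j k, B j j = 0 → B j k = 0 ∧ B k j = 0)
    (hAB : ∀ j k, B j j = 0 → A j k = 0 ∧ A k j = 0)
    (hup : ∀ j ∈ S, A j j ≤ (1 + ε) * B j j)
    (hK : ∀ j, 0 < B j j → A j j < K * B j j)
    (hT : ∀ f : Fin d → Fin p × Fin K × SignType,
      (1 - ε / 2) * ((∑ k, atom B K (f k)) ⬝ᵥ (B *ᵥ ∑ k, atom B K (f k))) ≤
        (∑ k, atom B K (f k)) ⬝ᵥ (A *ᵥ ∑ k, atom B K (f k))) :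
    (∀ j, (1 - ε) * B j j ≤ A j j) ∧
    ∀ x, diagSqrt A *ᵥ x ∈ cone S α → (1 - ε) * (x ⬝ᵥ (B *ᵥ x)) ≤ x ⬝ᵥ (A *ᵥ x) := by
  have hMε : 0 < 4 * M / ε := by positivity
  have hd2 : 2 ≤ d := by
    have h1 : 1 ≤ 4 * M / ε := by rw [le_div_iff₀ hε]; linarith
    have h2 : (2 : ℝ) ≤ d := by linarith
    exact_mod_cast h2
  obtain ⟨hlow', hquad⟩ := quadratic_lower_bound_of_atoms hK0 hd2 (by linarith) hA hnn hB hAB hK hT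
  have hlow : ∀ j, (1 - ε) * B j j ≤ A j j := fun j =>
    le_trans (mul_le_mul_of_nonneg_right (by linarith) (hnn j)) (hlow' j)
  refine ⟨hlow, fun x hx => ?_⟩
  set r := re (normalized B) S (α * √((1 + ε) / (1 - ε))) with hr
  have h1 := re_sq_mul_le_quadratic hnn hB hre
    (diagSqrt_mulVec_mem_cone hα hε hε' hlow hup hx)
  rw [← hr] at h1
  have h2 : (∑ j, √(A j j) * |x j|) ^ 2 ≤ M * (x ⬝ᵥ (B *ᵥ x)) := by
    have h3 := sq_sum_abs_le_of_mem_cone hα hx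
    have e1 : ∀ j, |(diagSqrt A *ᵥ x) j| = √(A j j) * |x j| := fun j => by
      simp [diagSqrt, Matrix.mulVec_diagonal, abs_mul, abs_of_nonneg (Real.sqrt_nonneg _)]
    have e2 : ∀ j, (diagSqrt A *ᵥ x) j ^ 2 = A j j * x j ^ 2 := fun j => by
      simp [diagSqrt, Matrix.mulVec_diagonal, mul_pow, Real.sq_sqrt (hA j)]
    simp only [e1, e2] at h3
    have h4 : ∑ j ∈ S, A j j * x j ^ 2 ≤ (1 + ε) * ∑ j ∈ S, B j j * x j ^ 2 := by
      rw [Finset.mul_sum]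
      refine Finset.sum_le_sum fun j hj => ?_
      rw [← mul_assoc]
      exact mul_le_mul_of_nonneg_right (hup j hj) (sq_nonneg _)
    calc _ ≤ (1 + α) ^ 2 * (S.card * ∑ j ∈ S, A j j * x j ^ 2) := h3
      _ ≤ (1 + α) ^ 2 * (S.card * ((1 + ε) * ∑ j ∈ S, B j j * x j ^ 2)) := by gcongr
      _ = M * (r ^ 2 * ∑ j ∈ S, B j j * x j ^ 2) := by
          rw [hM]; field_simp
      _ ≤ _ := by gcongr
  have hxB : 0 ≤ x ⬝ᵥ (B *ᵥ x) := nonneg_of_mul_nonneg_right ((sq_nonneg _).trans h2) (by linarith)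
  have h5 : 2 / ((d : ℝ) - 1) ≤ ε / (2 * M) := by
    have hd1 : 4 * M / ε ≤ (d : ℝ) - 1 := by linarith
    calc 2 / ((d : ℝ) - 1) ≤ 2 / (4 * M / ε) := by gcongr
      _ = ε / (2 * M) := by field_simp; norm_num
  have h6 : 2 / ((d : ℝ) - 1) * (∑ j, √(A j j) * |x j|) ^ 2 ≤ ε / 2 * (x ⬝ᵥ (B *ᵥ x)) := by
    calc _ ≤ ε / (2 * M) * (M * (x ⬝ᵥ (B *ᵥ x))) := by gcongr
      _ = _ := by field_simp
  have := hquad x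
  linarith

variable {Ω : Type*} [MeasurableSpace Ω]

/-- Outside an event of probability at most `δ`, the diagonals and the quadratic forms on the cone
compare as needed. Dimension one is separate: there `log (p / (4 δ))` may be negative, so the first
lower bound on `n` may be void, but the cone is everything and the diagonal settles the matter. -/
lemma exists_event (μ : Measure Ω) [IsProbabilityMeasure μ]
    {n p : ℕ} [NeZero n] {X : Fin n → Ω → Fin p → ℝ}
    (hX_meas : ∀ i, Measurable (X i)) (hX_indep : iIndepFun X μ)
    (hX_ident : ∀ i, IdentDistrib (X i) (X 0) μ μ) {q : ℝ} (hq : 2 < q)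
    (hX_moment : ∀ j, MemLp (fun ω => X 0 ω j) (ENNReal.ofReal (2 * q)) μ)
    {h hstar : ℝ} (hh : 1 < h) (hhstar : 1 < hstar)
    (h_four : ∀ v : Fin p → ℝ, l0Norm v ≤ n →
      √(∫ ω, (v ⬝ᵥ X 0 ω) ^ 4 ∂μ) ≤ h * (v ⬝ᵥ (secondMoment μ (X 0) *ᵥ v)))
    (h_coord : ∀ j : Fin p,
      (∫ ω, |X 0 ω j| ^ (2 * q) ∂μ) ^ (1 / q) ≤ hstar * ∫ ω, X 0 ω j ^ 2 ∂μ)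
    {δ ε : ℝ} (hδ : 0 < δ) (hδ' : δ < 1 / 2) (hε : 0 < ε) (hε' : ε < 1 / 2)
    {S : Finset (Fin p)} (hS : S.Nonempty) {α : ℝ} (hα : 0 < α)
    (hre : 0 < re (normalized (secondMoment μ (X 0))) S (α * √((1 + ε) / (1 - ε))))
    (hn1 : 784 * ((1 + ε) * (1 + α) ^ 2) * h ^ 2 * (1 + 2 * Real.log (p / (4 * δ))) /
      (re (normalized (secondMoment μ (X 0))) S (α * √((1 + ε) / (1 - ε))) ^ 2 * ε ^ 4) *
        (S.card : ℝ) ≤ n)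
    (hn2 : 4 * q ^ 2 * hstar ^ 2 * (3 : ℝ) ^ (2 / q) * (S.card : ℝ) ^ (2 / q) /
      (ε ^ 2 * δ ^ (2 / q)) ≤ n) :
    ∃ bad : Set Ω, MeasurableSet bad ∧ μ.real bad ≤ δ ∧ ∀ ω ∉ bad,
      (∀ j, (1 - ε) * secondMoment μ (X 0) j j ≤ sampleSecondMoment (fun i => X i ω) j j) ∧
      (∀ j ∈ S, sampleSecondMoment (fun i => X i ω) j j ≤
        (1 + ε) * secondMoment μ (X 0) j j) ∧
      ∀ x, diagSqrt (sampleSecondMoment fun i => X i ω) *ᵥ x ∈ cone S α →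
        (1 - ε) * (x ⬝ᵥ (secondMoment μ (X 0) *ᵥ x)) ≤
          x ⬝ᵥ ((sampleSecondMoment fun i => X i ω) *ᵥ x) := by
  have h4q : (4 : ENNReal) ≤ ENNReal.ofReal (2 * q) := by
    rw [← ENNReal.ofReal_ofNat 4]
    exact ENNReal.ofReal_le_ofReal (by linarith)
  have hL4 : ∀ j, MemLp (fun ω => X 0 ω j) 4 μ := fun j => (hX_moment j).mono_exponent h4q
  have hL2 : ∀ j, MemLp (fun ω => X 0 ω j) 2 μ := fun j =>
    (hL4 j).mono_exponent (by norm_num)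
  set B := secondMoment μ (X 0) with hBdef
  have hdiag : ∀ j, B j j = ∫ ω, X 0 ω j ^ 2 ∂μ := fun j => secondMoment_apply_self _ j
  have hnn : ∀ j, 0 ≤ B j j := fun j => secondMoment_apply_self_nonneg _ j
  have hB : ∀ j k, B j j = 0 → B j k = 0 ∧ B k j = 0 := fun j k =>
    secondMoment_eq_zero_of_diag hL2 j k
  have hαt : 0 < α * √((1 + ε) / (1 - ε)) :=
    mul_pos hα (Real.sqrt_pos.2 (div_pos (by linarith) (by linarith)))
  have hBS : ∀ j ∈ S, 0 < B j j := fun j hj => diag_pos_of_re_pos hαt hnn hre hj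
  have hAdiag : ∀ ω j, sampleSecondMoment (fun i => X i ω) j j =
      (n : ℝ)⁻¹ * ∑ i, X i ω j ^ 2 := fun ω j => by
    simp only [sampleSecondMoment_apply, sq]
  have hA : ∀ ω j, 0 ≤ sampleSecondMoment (fun i => X i ω) j j := fun ω j => by
    rw [hAdiag]
    exact mul_nonneg (by positivity) (Finset.sum_nonneg fun _ _ => sq_nonneg _)
  have hXj : ∀ i j, Measurable fun ω => X i ω j := fun i j => (measurable_pi_apply j).comp (hX_meas i)
  -- some diagonal entry in `S` deviates
  set bad₁ : Set Ω := ⋃ j ∈ S, {ω | ε * ∫ ω, X 0 ω j ^ 2 ∂μ <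
      |(n : ℝ)⁻¹ * ∑ i, X i ω j ^ 2 - ∫ ω, X 0 ω j ^ 2 ∂μ|} with hbad₁
  have hm₁ : MeasurableSet bad₁ := Finset.measurableSet_biUnion S fun j _ =>
    measurableSet_lt (by fun_prop) (by fun_prop)
  have hP₁ : μ.real bad₁ ≤ δ / 3 :=
    measureReal_diag_deviation_le hX_meas hX_indep hX_ident hq hX_moment hhstar h_coord hδ hε
      (fun j hj => hdiag j ▸ hBS j hj) hn2
  have hdev : ∀ ω ∉ bad₁, ∀ j ∈ S,
      (1 - ε) * B j j ≤ sampleSecondMoment (fun i => X i ω) j j ∧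
      sampleSecondMoment (fun i => X i ω) j j ≤ (1 + ε) * B j j := by
    intro ω hω j hj
    simp only [hbad₁, Set.mem_iUnion, Set.mem_ofPred_eq, not_exists, not_lt] at hω
    have h1 := abs_le.1 (hω j hj)
    rw [hAdiag, hdiag]
    constructor <;> linarith [h1.1, h1.2]
  have hp0 : p ≠ 0 := by
    rintro rfl
    exact hS.elim fun j _ => j.elim0
  rcases (by omega : p = 1 ∨ 2 ≤ p) with rfl | hp
  · refine ⟨bad₁, hm₁, by linarith, fun ω hω => ?_⟩
    have hall : ∀ j, j ∈ S := fun j => by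
      obtain ⟨k, hk⟩ := hS
      rwa [Subsingleton.elim j k]
    exact ⟨fun j => (hdev ω hω j (hall j)).1, fun j hj => (hdev ω hω j hj).2,
      fun x _ => one_dim_quadratic_le (hdev ω hω 0 (hall 0)).1 x⟩
  set r := re (normalized B) S (α * √((1 + ε) / (1 - ε))) with hr
  obtain ⟨M, hM⟩ : ∃ M, M = (1 + ε) * (1 + α) ^ 2 * S.card / r ^ 2 := ⟨_, rfl⟩
  have hM1 : 1 ≤ M := by
    have h1 : (1 : ℝ) ≤ S.card := by exact_mod_cast hS.card_pos
    obtain ⟨j, hj⟩ := hS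
    have h2 : r ^ 2 ≤ 1 := (re_sq_le hαt hre hj).trans (normalized_apply_self_le_one B j)
    rw [hM, one_le_div (by positivity)]
    calc r ^ 2 ≤ 1 * 1 ^ 2 * 1 := by linarith
      _ ≤ _ := by gcongr <;> linarith
  have hn1' : 784 * h ^ 2 * M * (1 + 2 * Real.log (p / (4 * δ))) / ε ^ 4 ≤ n := by
    refine le_trans (le_of_eq ?_) hn1
    rw [hM]
    field_simp
  obtain ⟨hdn, hunion⟩ := card_pow_mul_exp_le hp hδ hδ' hε hε' hh hM1 hn1'
  set d := ⌈4 * M / ε⌉₊ + 1 with hd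
  set K := ⌈3 * (p : ℝ) / δ⌉₊ with hKdef
  have hpR : (0 : ℝ) < p := by positivity
  have hKR : 3 * (p : ℝ) / δ ≤ K := Nat.le_ceil _
  have hKpos : (0 : ℝ) < K := lt_of_lt_of_le (by positivity) hKR
  have hK0 : 0 < K := by exact_mod_cast hKpos
  set T : Finset (Fin p) := Finset.univ.filter fun j => 0 < B j j with hT
  -- some diagonal entry exceeds every scale offered by the atoms
  set bad₂ : Set Ω := ⋃ j ∈ T, {ω | K * ∫ ω, X 0 ω j ^ 2 ∂μ ≤ (n : ℝ)⁻¹ * ∑ i, X i ω j ^ 2}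
    with hbad₂
  have hm₂ : MeasurableSet bad₂ := Finset.measurableSet_biUnion T fun j _ =>
    measurableSet_le (by fun_prop) (by fun_prop)
  have hP₂ : μ.real bad₂ ≤ δ / 3 := by
    refine (measureReal_diag_large_le hX_ident hL2 hKpos fun j hj => ?_).trans ?_
    · rw [← hdiag]
      exact (Finset.mem_filter.1 hj).2
    · rw [div_le_iff₀ hKpos]
      rw [div_le_iff₀ hδ] at hKR
      linarith
  set w : (Fin d → Fin p × Fin K × SignType) → Fin p → ℝ := fun f => ∑ k, atom B K (f k) with hw
  have hwB : ∀ f, w f ⬝ᵥ (B *ᵥ w f) = ∫ ω, (w f ⬝ᵥ X 0 ω) ^ 2 ∂μ := fun f =>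
    dotProduct_secondMoment_mulVec hL2 _
  -- the lower tail bound fails for some sum of `d` atoms
  set bad₃ : Set Ω := ⋃ f, {ω | (n : ℝ)⁻¹ * ∑ i, (w f ⬝ᵥ X i ω) ^ 2 <
      (1 - ε / 2) * ∫ ω, (w f ⬝ᵥ X 0 ω) ^ 2 ∂μ} with hbad₃
  have hm₃ : MeasurableSet bad₃ := MeasurableSet.iUnion fun f =>
    measurableSet_lt (by simp only [dotProduct]; fun_prop) (by fun_prop)
  have hP₃ : μ.real bad₃ ≤ δ / 3 := by
    refine (measureReal_iUnion_quadratic_lt_le hX_meas hX_indep hX_ident hL4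
      (by linarith : 0 < h) (by linarith : 0 ≤ ε / 2) w fun f => ?_).trans ?_
    · rw [← hwB]
      exact h_four _ ((l0Norm_sum_atom_le B f).trans hdn)
    · refine le_trans (le_of_eq ?_) hunion
      congr 1
      have h3 : Fintype.card SignType = 3 := rfl
      simp [h3]
  -- some coordinate of vanishing second moment is not zero
  set bad₀ : Set Ω := ⋃ j ∈ Tᶜ, ⋃ i, {ω | X i ω j ≠ 0} with hbad₀
  have hm₀ : MeasurableSet bad₀ := Finset.measurableSet_biUnion _ fun j _ =>
    MeasurableSet.iUnion fun i => (measurableSet_eq_fun (hXj i j) measurable_const).compl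
  have hP₀ : μ.real bad₀ = 0 := by
    rw [measureReal_eq_zero_iff (measure_ne_top μ _)]
    refine (measure_biUnion_null_iff (Finset.countable_toSet _)).2 fun j hj => ?_
    refine measure_iUnion_null fun i => ?_
    have hj0 : B j j = 0 := by
      have h1 : ¬ 0 < B j j := by simpa [hT] using hj
      exact le_antisymm (not_lt.1 h1) (hnn j)
    have h2 := ae_eq_zero_of_secondMoment_eq_zero (hL2 j) hj0
    have h3 := ((hX_ident i).symm.comp (measurable_pi_apply j)).ae_snd
      (p := fun t => t = 0) (measurableSet_singleton 0) h2
    exact h3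
  refine ⟨bad₀ ∪ bad₁ ∪ bad₂ ∪ bad₃, ((hm₀.union hm₁).union hm₂).union hm₃, ?_, fun ω hω => ?_⟩
  · linarith [measureReal_union_le (μ := μ) (bad₀ ∪ bad₁ ∪ bad₂) bad₃,
      measureReal_union_le (μ := μ) (bad₀ ∪ bad₁) bad₂, measureReal_union_le (μ := μ) bad₀ bad₁]
  · simp only [Set.mem_union, not_or] at hω
    obtain ⟨⟨⟨hω₀, hω₁⟩, hω₂⟩, hω₃⟩ := hω
    have hup : ∀ j ∈ S, sampleSecondMoment (fun i => X i ω) j j ≤ (1 + ε) * B j j :=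
      fun j hj => (hdev ω hω₁ j hj).2
    have hzero : ∀ j, B j j = 0 → ∀ i, X i ω j = 0 := by
      intro j hj i
      simp only [hbad₀, Set.mem_iUnion, Set.mem_ofPred_eq, not_exists, not_not] at hω₀
      exact hω₀ j (by simp [hT, hj]) i
    have hAB : ∀ j k, B j j = 0 → sampleSecondMoment (fun i => X i ω) j k = 0 ∧
        sampleSecondMoment (fun i => X i ω) k j = 0 := fun j k hj => by
      simp [sampleSecondMoment_apply, hzero j hj]
    have hAK : ∀ j, 0 < B j j → sampleSecondMoment (fun i => X i ω) j j < K * B j j := by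
      intro j hj
      simp only [hbad₂, Set.mem_iUnion, Set.mem_ofPred_eq, not_exists, not_le] at hω₂
      rw [hAdiag, hdiag]
      exact hω₂ j (by simpa [hT] using hj)
    obtain ⟨hlow, hquad⟩ := quadratic_lower_bound_on_cone hα hε hε' hre hM hK0 hM1
      (by rw [hd]; push_cast; gcongr; exact Nat.le_ceil _ : 4 * M / ε + 1 ≤ (d : ℝ)) (hA ω) hnn hB
      hAB hup hAK fun f => by
        simp only [hbad₃, Set.mem_iUnion, Set.mem_ofPred_eq, not_exists, not_lt] at hω₃
        rw [dotProduct_sampleSecondMoment_mulVec]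
        exact (hwB f) ▸ hω₃ f
    exact ⟨hlow, hup, hquad⟩

end RestrictedEigenvalue

theorem theorem5p2 {Ω : Type*} [MeasurableSpace Ω] (μ : Measure Ω) [IsProbabilityMeasure μ]
    {n p : ℕ} [NeZero n] (X : Fin n → Ω → Fin p → ℝ)
    (hX_meas : ∀ i, Measurable (X i))
    (hX_indep : iIndepFun X μ)
    (hX_ident : ∀ i, IdentDistrib (X i) (X 0) μ μ)
    (q : ℝ) (hq : 2 < q)
    (hX_moment : ∀ i j, MemLp (fun ω => X i ω j) (ENNReal.ofReal (2 * q)) μ)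
    (h hstar : ℝ) (hh : 1 < h) (hhstar : 1 < hstar)
    (h_four : ∀ v : Fin p → ℝ, RestrictedEigenvalue.l0Norm v ≤ n →
      √(∫ ω, (v ⬝ᵥ X 0 ω) ^ 4 ∂μ) ≤
        h * (v ⬝ᵥ (RestrictedEigenvalue.secondMoment μ (X 0) *ᵥ v)))
    (h_coord : ∀ j : Fin p,
      (∫ ω, |X 0 ω j| ^ (2 * q) ∂μ) ^ (1 / q) ≤ hstar * ∫ ω, X 0 ω j ^ 2 ∂μ)
    (δ ε : ℝ) (hδ : 0 < δ) (hδ' : δ < 1 / 2) (hε : 0 < ε) (hε' : ε < 1 / 2)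
    (S : Finset (Fin p)) (hS : S.Nonempty) (α : ℝ) (hα : 0 < α)
    (αt : ℝ) (hαt : αt = α * √((1 + ε) / (1 - ε)))
    (C : ℝ) (hC : C = 784 * ((1 + ε) * (1 + α) ^ 2) * h ^ 2)
    (h_re : 0 < RestrictedEigenvalue.re
      (RestrictedEigenvalue.normalized (RestrictedEigenvalue.secondMoment μ (X 0))) S αt)
    (hn : max
        (C * (1 + 2 * Real.log (p / (4 * δ))) /
          (RestrictedEigenvalue.re (RestrictedEigenvalue.normalized
            (RestrictedEigenvalue.secondMoment μ (X 0))) S αt ^ 2 * ε ^ 4) * (S.card : ℝ))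
        (4 * q ^ 2 * hstar ^ 2 * (3 : ℝ) ^ (2 / q) * (S.card : ℝ) ^ (2 / q) /
          (ε ^ 2 * δ ^ (2 / q))) ≤ (n : ℝ)) :
    ∃ E : Set Ω, MeasurableSet E ∧ ENNReal.ofReal (1 - δ) ≤ μ E ∧ ∀ ω ∈ E,
      (∀ x : Fin p → ℝ,
        RestrictedEigenvalue.diagSqrt
            (RestrictedEigenvalue.sampleSecondMoment fun i => X i ω) *ᵥ x
          ∈ RestrictedEigenvalue.cone S α →
        RestrictedEigenvalue.diagSqrt (RestrictedEigenvalue.secondMoment μ (X 0)) *ᵥ x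
          ∈ RestrictedEigenvalue.cone S αt) ∧
      (∀ x : Fin p → ℝ,
        RestrictedEigenvalue.diagSqrt
            (RestrictedEigenvalue.sampleSecondMoment fun i => X i ω) *ᵥ x
          ∈ RestrictedEigenvalue.cone S α →
        (1 - ε) ^ 2 * (x ⬝ᵥ (RestrictedEigenvalue.secondMoment μ (X 0) *ᵥ x)) ≤
          x ⬝ᵥ ((RestrictedEigenvalue.sampleSecondMoment fun i => X i ω) *ᵥ x)) ∧
      (1 - ε) * RestrictedEigenvalue.re
          (RestrictedEigenvalue.normalized
            (RestrictedEigenvalue.secondMoment μ (X 0))) S αt ≤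
        RestrictedEigenvalue.re
          (RestrictedEigenvalue.normalized
            (RestrictedEigenvalue.sampleSecondMoment fun i => X i ω)) S α := by
  subst hαt hC
  have hMoment0 := hX_moment 0
  have hL2 : ∀ j, MemLp (fun ω => X 0 ω j) 2 μ := fun j => by
    refine (hMoment0 j).mono_exponent ?_
    rw [← ENNReal.ofReal_ofNat 2]
    exact ENNReal.ofReal_le_ofReal (by linarith)
  obtain ⟨bad, hmeas, hprob, hbad⟩ := RestrictedEigenvalue.exists_event μ hX_meas hX_indep
    hX_ident hq hMoment0 hh hhstar h_four h_coord hδ hδ' hε hε' hS hα h_re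
    ((le_max_left _ _).trans hn) ((le_max_right _ _).trans hn)
  refine ⟨badᶜ, hmeas.compl, ?_, fun ω hω => ?_⟩
  · rw [← ENNReal.ofReal_toReal (measure_ne_top μ badᶜ)]
    refine ENNReal.ofReal_le_ofReal ?_
    have := probReal_compl_eq_one_sub (μ := μ) hmeas
    rw [measureReal_def] at this
    linarith
  obtain ⟨hlow, hup, hquad⟩ := hbad ω hω
  have hnn := RestrictedEigenvalue.secondMoment_apply_self_nonneg (μ := μ) (X 0)
  have hA : ∀ j, 0 ≤ RestrictedEigenvalue.sampleSecondMoment (fun i => X i ω) j j := fun j =>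
    (mul_nonneg (by linarith) (hnn j)).trans (hlow j)
  have hB := RestrictedEigenvalue.secondMoment_eq_zero_of_diag hL2
  have hcone : ∀ x, _ → _ := fun x hx =>
    RestrictedEigenvalue.diagSqrt_mulVec_mem_cone (x := x) hα hε hε' hlow hup hx
  refine ⟨hcone, fun x hx => ?_, ?_⟩
  · refine le_trans (mul_le_mul_of_nonneg_right ?_ ?_) (hquad x hx)
    · nlinarith
    · rw [RestrictedEigenvalue.dotProduct_secondMoment_mulVec hL2]
      exact integral_nonneg fun _ => sq_nonneg _
  · exact RestrictedEigenvalue.one_sub_mul_re_le hS hα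
      (mul_pos hα (Real.sqrt_pos.2 (div_pos (by linarith) (by linarith)))) hε hε' hA hnn hB h_re
      hlow hup hcone hquad
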